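/- Consider the delay differential algebraic system $$E\dot x(t)=A_0x(t)+\sum_{i=1}^m A_i x(t-\tau_i)+Bw(t),\qquad z(t)=Cx(t),$$ where $E,A_0,\dots,A_m\in\mathbb R^{n\times n}$, $B\in\mathbb R^{n\times p}$, $C\in\mathbb R^{q\times n}$ and $E$ may be singular. Let $\nu=n-\operatorname{rank}E$, and let the columns of $U,V\in\mathbb R^{n\times\nu}$ be bases of the left and right nullspaces of $E$, i.e. of $\{u:u^TE=0\}$ and $\{v:Ev=0\}$. Assume that $U^TA_0V$ is nonsingular (index one). For a delay vector $\vec\tau=(\tau_1,\dots,\tau_m)\in[0,\infty)^m$ define the transfer function and the asymptotic transfer function $$T(\lambda,\vec\tau)=C\Big(\lambda E-A_0-\sum_{i=1}^mA_ie^{-\lambda\tau_i}\Big)^{-1}B,\qquad T_a(\lambda,\vec\tau)=-CV\Big(U^TA_0V+\sum_{i=1}^mU^TA_iVe^{-\lambda\tau_i}\Big)^{-1}U^TB .$$ For $G\in\{T,T_a\}$ put $$\|G(j\omega,\vec\tau)\|_\infty=\sup_{\omega\in\mathbb R}\sigma_1\big(G(j\omega,\vec\tau)\big),\qquad |||G(j\omega,\vec\tau)|||_\infty=\lim_{\epsilon\to0+}\sup\big\{\|G(j\omega,\vec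 r)\|_\infty:\ \vec r\in[0,\infty)^m,\ \|\vec r-\vec\tau\|<\epsilon\big\},$$ where $\sigma_1$ is the largest singular value; the second quantity is the strong $\mathcal H_\infty$ norm. The zero solution with $w\equiv0$ is exponentially stable for the delays $\vec r$ if there are $K$ and $\alpha>0$ such that $\|x(t)\|\le Ke^{-\alpha t}\sup_{s\in[-\max_i r_i,0]}\|x(s)\|$ for all $t\ge0$ and every solution $x$, that is, every continuous $x:[-\max_i r_i,\infty)\to\mathbb R^n$ such that $Ex$ is differentiable on $[0,\infty)$ and $\frac{d}{dt}(Ex)(t)=A_0x(t)+\sum_iA_ix(t-r_i)$ for $t\ge0$. It is strongly exponentially stable at $\vec\tau$ if there is $\epsilon>0$ such that it is exponentially stable for all $\vec r\in[0,\infty)^m$ with $\|\vec r-\vec\tau\|<\epsilon$. **Theorem.** Let $\vec\tau\in(0,\infty)^m$ be a delay vector at which the zero solution is strongly exponentially stable. Then $|||T(j\omega,\vec\tau)|||_\infty$ is finite, $$|||T(j\omega,\vec\tau)|||_\infty=\max\big(\|T(j\omega,\vec\tau)\|_\infty,\ |||T_a(j\omega,\vec\tau)|||_\infty\big),$$ and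 the function $\vec r\in(0,\infty)^m\mapsto|||T(j\omega,\vec r)|||_\infty\in[0,\infty]$ is continuous at $\vec\tau$. In particular, this function is continuous on all of $(0,\infty)^m$ if the zero solution is strongly exponentially stable at every $\vec\tau\in(0,\infty)^m$. -/

import Mathlib

open Set Filter Topology Matrix
open scoped ENNReal

/-- The data of a linear delay differential algebraic system with `m` point-wise delays,
`E x'(t) = A₀ x(t) + ∑ i, A i x(t - τ i) + B w(t)`, `z(t) = C x(t)`,
with `n` states, `p` inputs and `q` outputs.  The matrix `E` may be singular.
The delays are kept separate from the matrices. -/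
structure DDAE (n m p q : ℕ) where
  E : Matrix (Fin n) (Fin n) ℝ
  A₀ : Matrix (Fin n) (Fin n) ℝ
  A : Fin m → Matrix (Fin n) (Fin n) ℝ
  B : Matrix (Fin n) (Fin p) ℝ
  C : Matrix (Fin q) (Fin n) ℝ

/-- The columns of `V` form a basis of the right nullspace `{x | M x = 0}` of `M`. -/
structure IsNullspaceBasis {n ν : ℕ} (M : Matrix (Fin n) (Fin n) ℝ)
    (V : Matrix (Fin n) (Fin ν) ℝ) : Prop where
  linearIndependent : LinearIndependent ℝ V.col
  span_eq : Submodule.span ℝ (Set.range V.col) = LinearMap.ker M.mulVecLin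

/-- The largest singular value `σ₁(M)` (singular values are indexed from `0` in Mathlib). -/
noncomputable def sigmaMax {p q : ℕ} (M : Matrix (Fin q) (Fin p) ℂ) : ℝ :=
  (Matrix.toEuclideanLin M).singularValues 0

/-- The H-infinity norm `sup_{ω ∈ ℝ} σ₁(G(jω))`, with values in `[0, ∞]`. -/
noncomputable def hinfNorm {p q : ℕ} (G : ℂ → Matrix (Fin q) (Fin p) ℂ) : ℝ≥0∞ :=
  ⨆ ω : ℝ, ENNReal.ofReal (sigmaMax (G (ω * Complex.I)))

/-- The supremum of the H-infinity norms of `G r` over all vectors `r` of nonnegative delays in the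
open (Euclidean) ball of radius `ε` centred at `τ`. -/
noncomputable def supHinfNorm {m p q : ℕ}
    (G : EuclideanSpace ℝ (Fin m) → ℂ → Matrix (Fin q) (Fin p) ℂ)
    (τ : EuclideanSpace ℝ (Fin m)) (ε : ℝ) : ℝ≥0∞ :=
  ⨆ r ∈ Metric.ball τ ε ∩ {r | ∀ i, 0 ≤ r i}, hinfNorm (G r)

/-- The strong H-infinity norm at the delay vector `τ` of a family `G` of transfer functions
parametrized by the delays: the limit of `supHinfNorm G τ ε` as `ε → 0+`.
The limit always exists, see `tendsto_strongHinfNorm`. -/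
noncomputable def strongHinfNorm {m p q : ℕ}
    (G : EuclideanSpace ℝ (Fin m) → ℂ → Matrix (Fin q) (Fin p) ℂ)
    (τ : EuclideanSpace ℝ (Fin m)) : ℝ≥0∞ :=
  limUnder (𝓝[>] (0 : ℝ)) (supHinfNorm G τ)

theorem supHinfNorm_mono {m p q : ℕ}
    (G : EuclideanSpace ℝ (Fin m) → ℂ → Matrix (Fin q) (Fin p) ℂ)
    (τ : EuclideanSpace ℝ (Fin m)) : Monotone (supHinfNorm G τ) := by
  intro a b hab
  exact biSup_mono fun r hr => ⟨Metric.ball_subset_ball hab hr.1, hr.2⟩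

/-- The limit in the definition of the strong H-infinity norm exists. -/
theorem tendsto_strongHinfNorm {m p q : ℕ}
    (G : EuclideanSpace ℝ (Fin m) → ℂ → Matrix (Fin q) (Fin p) ℂ)
    (τ : EuclideanSpace ℝ (Fin m)) :
    Tendsto (supHinfNorm G τ) (𝓝[>] (0 : ℝ)) (𝓝 (strongHinfNorm G τ)) :=
  tendsto_nhds_limUnder ⟨_, (supHinfNorm_mono G τ).tendsto_nhdsGT 0⟩

namespace DDAE

variable {n m p q ν : ℕ}

/-- `x` is a forward solution on `[0, ∞)` of the unforced system (`w = 0`) with delays `r`: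
`x` is continuous on `[-max r, ∞)`, the function `E x` is differentiable on `[0, ∞)` (one-sidedly
at `0`), and `d/dt (E x)(t) = A₀ x(t) + ∑ i, A i x(t - r i)` for all `t ≥ 0`. -/
structure IsSolution (S : DDAE n m p q) (r : EuclideanSpace ℝ (Fin m))
    (x : ℝ → Fin n → ℝ) : Prop where
  continuousOn : ContinuousOn x (Ici (-(⨆ i, r i)))
  hasDerivWithinAt : ∀ t : ℝ, 0 ≤ t →
    HasDerivWithinAt (fun s => S.E *ᵥ x s)
      (S.A₀ *ᵥ x t + ∑ i, S.A i *ᵥ x (t - r i)) (Ici 0) t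

/-- The zero solution of the unforced system with delays `r` is exponentially stable: there are
`K` and `α > 0` such that `‖x t‖ ≤ K e^{-α t} sup_{s ∈ [-max r, 0]} ‖x s‖` for all solutions `x`
and all `t ≥ 0`.  The supremum is written through its upper bounds `M`. -/
def IsExpStable (S : DDAE n m p q) (r : EuclideanSpace ℝ (Fin m)) : Prop :=
  ∃ K α : ℝ, 0 < α ∧ ∀ x : ℝ → Fin n → ℝ, S.IsSolution r x →
    ∀ M : ℝ, (∀ s ∈ Icc (-(⨆ i, r i)) 0, ‖x s‖ ≤ M) →
      ∀ t : ℝ, 0 ≤ t → ‖x t‖ ≤ K * Real.exp (-α * t) * M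

/-- The zero solution of the unforced system is strongly exponentially stable at the delays `τ`:
exponential stability persists for all sufficiently small perturbations of the delays (among
nonnegative delays). -/
def IsStronglyExpStable (S : DDAE n m p q) (τ : EuclideanSpace ℝ (Fin m)) : Prop :=
  ∃ ε : ℝ, 0 < ε ∧ ∀ r ∈ Metric.ball τ ε ∩ {r | ∀ i, 0 ≤ r i}, S.IsExpStable r

/-- The characteristic matrix `λ E - A₀ - ∑ i, A i e^{-λ τ i}`. -/
noncomputable def charMatrix (S : DDAE n m p q) (τ : EuclideanSpace ℝ (Fin m)) (z : ℂ) :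
    Matrix (Fin n) (Fin n) ℂ :=
  z • S.E.map Complex.ofReal - S.A₀.map Complex.ofReal
    - ∑ i, Complex.exp (-(z * (τ i : ℂ))) • (S.A i).map Complex.ofReal

/-- The transfer function `T(λ, τ) = C (λ E - A₀ - ∑ i, A i e^{-λ τ i})⁻¹ B`. -/
noncomputable def transferFunction (S : DDAE n m p q) (τ : EuclideanSpace ℝ (Fin m)) (z : ℂ) :
    Matrix (Fin q) (Fin p) ℂ :=
  S.C.map Complex.ofReal * (S.charMatrix τ z)⁻¹ * S.B.map Complex.ofReal

/-- The matrix `Uᵀ A₀ V + ∑ i, Uᵀ (A i) V e^{-λ τ i}`. -/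
noncomputable def algebraicMatrix (S : DDAE n m p q) (U V : Matrix (Fin n) (Fin ν) ℝ)
    (τ : EuclideanSpace ℝ (Fin m)) (z : ℂ) : Matrix (Fin ν) (Fin ν) ℂ :=
  (Uᵀ * S.A₀ * V).map Complex.ofReal
    + ∑ i, Complex.exp (-(z * (τ i : ℂ))) • (Uᵀ * S.A i * V).map Complex.ofReal

/-- The asymptotic transfer function
`T_a(λ, τ) = - C V (Uᵀ A₀ V + ∑ i, Uᵀ (A i) V e^{-λ τ i})⁻¹ Uᵀ B`. -/
noncomputable def asymptoticTransferFunction (S : DDAE n m p q)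
    (U V : Matrix (Fin n) (Fin ν) ℝ) (τ : EuclideanSpace ℝ (Fin m)) (z : ℂ) :
    Matrix (Fin q) (Fin p) ℂ :=
  -((S.C * V).map Complex.ofReal * (S.algebraicMatrix U V τ z)⁻¹
    * (Uᵀ * S.B).map Complex.ofReal)

end DDAE

/-!
Write `s i` for the factor `e^{-z r i}` and `A(s) = A₀ + ∑ i, s i A i`.  On the imaginary axis the
vector `s` lies on the torus `‖s i‖ = 1`, and the transfer function at `z` depends on the delays
only through `s`: it is `C (z E - A(s))⁻¹ B`.

*High frequencies.*  Choose `G` and `W` with `E G + W Uᵀ = 1`.  If `Uᵀ A(s) V` is invertible and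
`P = V (Uᵀ A(s) V)⁻¹ Uᵀ`, then `-P + z⁻¹ G (1 - A(s) P)` is a right inverse of `z E - A(s)` up to
`O(z⁻¹)`.  Hence `(z E - A(s))⁻¹ → -P` as `|z| → ∞`, uniformly for `s` in compact sets on which
`Uᵀ A(s) V` is invertible (`pencil_inv_add_le`,
`DDAE.exists_forall_norm_inv_add_limitResolvent_le`).  So at high frequencies the transfer function
is uniformly close to the asymptotic one, whatever the delays are, as soon as `Uᵀ A(s) V` is
invertible on the whole torus.

*Invertibility on the torus* (`DDAE.IsStronglyExpStable.isUnit_reducedMatrix`).  Exponential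
stability for the delays `r` forces the characteristic matrix to be invertible on a half plane
`Re z > -α` with `α > 0`.  If `Uᵀ A(s) V` were singular at a point of the torus, this point would be
the vector of factors at some `iω` for delays `r` arbitrarily close to `τ`
(`DDAE.exists_mem_ball_exp_eq`).  Since `ω ↦ s` is recurrent, there are `ω_k → ∞` along which the
factors nearly return to their values around `iω`.  On a small circle around `iω`, shifted by
`iω_k`, the inverse of the characteristic matrix is bounded uniformly in `k` by the high frequency
estimate, hence by the maximum modulus principle it is bounded at the centres as well.  But near the
centres a null vector of `Uᵀ A(s) V` yields approximate null vectors of the characteristic matrix, a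
contradiction.

*Conclusion.*  Let `N` be the maximum over the torus of the norm of the asymptotic transfer
function.  Every point of the torus is attained at arbitrarily high frequency by delays arbitrarily
close to the given ones, so the strong norm of the asymptotic transfer function is `N` at every
positive delay vector, and the strong norm of the transfer function is at least `N`.  On bounded
frequency intervals the transfer function depends continuously on the delays, uniformly in the
frequency; outside such an interval its norm is at most `N` up to a small error.  This gives the
formula `max (hinfNorm (T τ)) N` for the strong norm, and since `N` does not depend on the delays,
also its continuity.
-/

section

open scoped Matrix.Norms.L2Operator

-- In all estimates matrices carry the operator norm for Euclidean norms, which equals `sigmaMax`.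

/-! ### The largest singular value is the operator norm -/

/-- Expansion of `x` in an orthonormal basis of eigenvectors of `T† T`, whose eigenvalues are the
squares of the singular values. -/
theorem LinearMap.norm_apply_le_singularValues_zero {E F : Type*} [NormedAddCommGroup E]
    [InnerProductSpace ℂ E] [FiniteDimensional ℂ E] [NormedAddCommGroup F] [InnerProductSpace ℂ F]
    [FiniteDimensional ℂ F] (T : E →ₗ[ℂ] F) (x : E) :
    ‖T x‖ ≤ T.singularValues 0 * ‖x‖ := by
  have hS := T.isSymmetric_adjoint_comp_self
  obtain ⟨n, hn⟩ : ∃ n, Module.finrank ℂ E = n := ⟨_, rfl⟩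
  set b := hS.eigenvectorBasis hn
  have h1 : ‖T x‖ ^ 2 = ∑ i, hS.eigenvalues hn i * ‖inner ℂ (b i) x‖ ^ 2 := by
    have h2 : inner ℂ (T x) (T x) = inner ℂ x ((T.adjoint ∘ₗ T) x) := by
      simp [LinearMap.adjoint_inner_right]
    rw [← inner_self_eq_norm_sq (𝕜 := ℂ), h2, ← b.sum_inner_mul_inner, map_sum]
    refine Finset.sum_congr rfl fun i _ => ?_
    have h3 : inner ℂ (b i) ((T.adjoint ∘ₗ T) x) = (hS.eigenvalues hn i : ℂ) * inner ℂ (b i) x := by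
      rw [← hS, hS.apply_eigenvectorBasis hn i, inner_smul_left]
      simp [b]
    rw [h3, ← inner_conj_symm x (b i), mul_left_comm, RCLike.conj_mul,
      ← RCLike.ofReal_pow]
    exact RCLike.re_ofReal_mul _ _ |>.trans (by rw [RCLike.ofReal_re])
  have h4 : ‖T x‖ ^ 2 ≤ (T.singularValues 0 * ‖x‖) ^ 2 := by
    rw [h1, mul_pow, ← b.sum_sq_norm_inner_right x, Finset.mul_sum]
    refine Finset.sum_le_sum fun i _ => ?_
    rw [← T.sq_singularValues_fin hn i]
    have := T.singularValues_antitone (Nat.zero_le i)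
    have := T.singularValues_nonneg i
    gcongr
  exact le_of_sq_le_sq h4 (mul_nonneg (T.singularValues_nonneg 0) (norm_nonneg x))

theorem LinearMap.exists_norm_apply_eq_singularValues_zero {E F : Type*} [NormedAddCommGroup E]
    [InnerProductSpace ℂ E] [FiniteDimensional ℂ E] [Nontrivial E] [NormedAddCommGroup F]
    [InnerProductSpace ℂ F] [FiniteDimensional ℂ F] (T : E →ₗ[ℂ] F) :
    ∃ x ≠ 0, ‖T x‖ = T.singularValues 0 * ‖x‖ := by
  obtain ⟨x, hx⟩ := (T.hasEigenvalue_adjoint_comp_self_sq_singularValues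
    (Module.finrank_pos (R := ℂ) (M := E))).exists_hasEigenvector
  refine ⟨x, hx.2, ?_⟩
  have h2 : inner ℂ (T x) (T x) = inner ℂ x ((T.adjoint ∘ₗ T) x) := by
    simp [LinearMap.adjoint_inner_right]
  have h3 : ‖T x‖ ^ 2 = (T.singularValues 0 * ‖x‖) ^ 2 := by
    rw [hx.apply_eq_smul, inner_smul_right, inner_self_eq_norm_sq_to_K,
      inner_self_eq_norm_sq_to_K] at h2
    rw [mul_pow]
    exact_mod_cast h2
  exact (sq_eq_sq₀ (norm_nonneg _)
    (mul_nonneg (T.singularValues_nonneg 0) (norm_nonneg x))).1 h3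

theorem sigmaMax_eq_norm {p q : ℕ} (M : Matrix (Fin q) (Fin p) ℂ) : sigmaMax M = ‖M‖ := by
  unfold sigmaMax
  apply le_antisymm
  · rcases Nat.eq_zero_or_pos p with rfl | hp
    · rw [LinearMap.singularValues_of_finrank_le _ (by simp)]
      exact norm_nonneg M
    · have : Nonempty (Fin p) := ⟨⟨0, hp⟩⟩
      obtain ⟨x, hx, h⟩ := (Matrix.toEuclideanLin M).exists_norm_apply_eq_singularValues_zero
      have := l2_opNorm_mulVec M x
      exact le_of_mul_le_mul_right (h.symm.le.trans this) (norm_pos_iff.2 hx)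
  · rw [l2_opNorm_def]
    exact ContinuousLinearMap.opNorm_le_bound _ (LinearMap.singularValues_nonneg _ _)
      fun x => LinearMap.norm_apply_le_singularValues_zero _ x

/-! ### The `H∞` norm and the strong `H∞` norm -/

theorem ofReal_norm_le_hinfNorm {p q : ℕ} (G : ℂ → Matrix (Fin q) (Fin p) ℂ) (ω : ℝ) :
    ENNReal.ofReal ‖G (ω * Complex.I)‖ ≤ hinfNorm G := by
  rw [← sigmaMax_eq_norm]
  exact le_iSup (fun ω : ℝ => ENNReal.ofReal (sigmaMax (G (ω * Complex.I)))) ω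

theorem hinfNorm_le {p q : ℕ} {G : ℂ → Matrix (Fin q) (Fin p) ℂ} {a : ℝ≥0∞}
    (h : ∀ ω : ℝ, ENNReal.ofReal ‖G (ω * Complex.I)‖ ≤ a) : hinfNorm G ≤ a :=
  iSup_le fun ω => by rw [sigmaMax_eq_norm]; exact h ω

theorem ofReal_norm_le_add {k l : ℕ} {M N : Matrix (Fin k) (Fin l) ℂ} {η : ℝ}
    (h : ‖M - N‖ ≤ η) : ENNReal.ofReal ‖M‖ ≤ ENNReal.ofReal ‖N‖ + ENNReal.ofReal η := by
  rw [← ENNReal.ofReal_add (norm_nonneg _) ((norm_nonneg _).trans h)]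
  refine ENNReal.ofReal_le_ofReal ?_
  have := norm_add_le (M - N) N
  rw [sub_add_cancel] at this
  linarith

theorem isCompact_setOf_forall_norm_eq_one {m : ℕ} :
    IsCompact {s : Fin m → ℂ | ∀ i, ‖s i‖ = 1} := by
  convert isCompact_univ_pi fun _ : Fin m => isCompact_sphere (0 : ℂ) 1
  ext s
  simp

theorem strongHinfNorm_le_supHinfNorm {m p q : ℕ}
    (G : EuclideanSpace ℝ (Fin m) → ℂ → Matrix (Fin q) (Fin p) ℂ) (τ : EuclideanSpace ℝ (Fin m))
    {ε : ℝ} (hε : 0 < ε) : strongHinfNorm G τ ≤ supHinfNorm G τ ε := by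
  refine le_of_tendsto (tendsto_strongHinfNorm G τ) ?_
  filter_upwards [Ioo_mem_nhdsGT hε] with δ hδ
  exact supHinfNorm_mono G τ hδ.2.le

theorem le_strongHinfNorm {m p q : ℕ}
    {G : EuclideanSpace ℝ (Fin m) → ℂ → Matrix (Fin q) (Fin p) ℂ} {τ : EuclideanSpace ℝ (Fin m)}
    {a : ℝ≥0∞} (h : ∀ ε : ℝ, 0 < ε → a ≤ supHinfNorm G τ ε) : a ≤ strongHinfNorm G τ := by
  refine ge_of_tendsto (tendsto_strongHinfNorm G τ) ?_
  filter_upwards [self_mem_nhdsWithin] with ε hε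
  exact h ε hε

theorem hinfNorm_le_supHinfNorm {m p q : ℕ}
    (G : EuclideanSpace ℝ (Fin m) → ℂ → Matrix (Fin q) (Fin p) ℂ) {τ r : EuclideanSpace ℝ (Fin m)}
    {ε : ℝ} (hr : r ∈ Metric.ball τ ε) (hr0 : ∀ i, 0 ≤ r i) :
    hinfNorm (G r) ≤ supHinfNorm G τ ε :=
  le_biSup (fun r => hinfNorm (G r)) (show r ∈ Metric.ball τ ε ∩ {r | ∀ i, 0 ≤ r i} from ⟨hr, hr0⟩)

/-! ### Matrices with real and complex entries -/

theorem Matrix.map_mulVec_ofReal {k l : ℕ} (φ : ℂ →L[ℝ] ℝ) (M : Matrix (Fin k) (Fin l) ℝ)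
    (w : Fin l → ℂ) (i : Fin k) :
    (M *ᵥ fun j => φ (w j)) i = φ ((M.map Complex.ofReal *ᵥ w) i) := by
  simp only [mulVec, dotProduct, map_sum, Matrix.map_apply]
  refine Finset.sum_congr rfl fun j _ => ?_
  rw [← Complex.real_smul, map_smul, smul_eq_mul]

theorem Matrix.map_ofReal_mul {k l o : ℕ} (M : Matrix (Fin k) (Fin l) ℝ)
    (N : Matrix (Fin l) (Fin o) ℝ) :
    (M * N).map Complex.ofReal = M.map Complex.ofReal * N.map Complex.ofReal :=
  Matrix.map_mul (f := Complex.ofRealHom)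

theorem Matrix.map_ofReal_one {k : ℕ} : (1 : Matrix (Fin k) (Fin k) ℝ).map Complex.ofReal = 1 :=
  Matrix.map_one _ Complex.ofReal_zero Complex.ofReal_one

theorem Matrix.tendsto_mul {k l o : ℕ} {A : ℕ → Matrix (Fin k) (Fin l) ℂ}
    {X : ℕ → Matrix (Fin l) (Fin o) ℂ} {a : Matrix (Fin k) (Fin l) ℂ} {x : Matrix (Fin l) (Fin o) ℂ}
    (hA : Tendsto A atTop (𝓝 a)) (hX : Tendsto X atTop (𝓝 x)) :
    Tendsto (fun k => A k * X k) atTop (𝓝 (a * x)) := by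
  have h : Continuous fun P : Matrix (Fin k) (Fin l) ℂ × Matrix (Fin l) (Fin o) ℂ => P.1 * P.2 :=
    continuous_fst.matrix_mul continuous_snd
  have hAX : Tendsto (fun k => (A k, X k)) atTop (𝓝 (a, x)) := hA.prodMk_nhds hX
  have h' := h.tendsto (a, x)
  exact Tendsto.comp (f := fun k => (A k, X k)) h' hAX

theorem Matrix.continuousAt_inv {k : ℕ} {M : Matrix (Fin k) (Fin k) ℂ} (hM : IsUnit M) :
    ContinuousAt (fun N : Matrix (Fin k) (Fin k) ℂ => N⁻¹) M := by
  simp only [nonsing_inv_eq_ringInverse]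
  exact hM.unit_spec ▸ NormedRing.inverse_continuousAt hM.unit

/-! ### Resolvents of singular pencils -/

/-- The range of `E` is the kernel of `Uᵀ`, expressed by a matrix identity: `E * G` is the identity
on the kernel of `Uᵀ`. As an identity between real matrices it carries over to complex matrices. -/
theorem IsNullspaceBasis.exists_mul_add_mul_transpose_eq_one {n ν : ℕ}
    {E : Matrix (Fin n) (Fin n) ℝ} {U : Matrix (Fin n) (Fin ν) ℝ} (hU : IsNullspaceBasis Eᵀ U) :
    ∃ (G : Matrix (Fin n) (Fin n) ℝ) (W : Matrix (Fin n) (Fin ν) ℝ), E * G + W * Uᵀ = 1 := by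
  have hEU : Eᵀ * U = 0 := by
    ext i j
    have h : U.col j ∈ LinearMap.ker Eᵀ.mulVecLin := by
      rw [← hU.span_eq]; exact Submodule.subset_span ⟨j, rfl⟩
    exact congrFun (LinearMap.mem_ker.1 h) i
  have hUE : Uᵀ * E = 0 := by simpa using congrArg transpose hEU
  -- `Q` is invertible, and it commutes with both summands because `Uᵀ * E = 0`.
  set Q := E * Eᵀ + U * Uᵀ with hQ
  have hdet : IsUnit Q.det := by
    rw [isUnit_iff_ne_zero]
    intro h0
    obtain ⟨y, hy, hQy⟩ := exists_mulVec_eq_zero_iff.2 h0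
    have h1 : (Eᵀ *ᵥ y) ⬝ᵥ (Eᵀ *ᵥ y) + (Uᵀ *ᵥ y) ⬝ᵥ (Uᵀ *ᵥ y) = 0 := by
      have : y ⬝ᵥ (Q *ᵥ y) = 0 := by rw [hQy, dotProduct_zero]
      rw [hQ, add_mulVec, dotProduct_add, ← mulVec_mulVec, ← mulVec_mulVec,
        dotProduct_mulVec, dotProduct_mulVec y, ← mulVec_transpose, ← mulVec_transpose] at this
      exact this
    have h2 : 0 ≤ (Eᵀ *ᵥ y) ⬝ᵥ (Eᵀ *ᵥ y) := Finset.sum_nonneg fun i _ => mul_self_nonneg _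
    have h3 : 0 ≤ (Uᵀ *ᵥ y) ⬝ᵥ (Uᵀ *ᵥ y) := Finset.sum_nonneg fun i _ => mul_self_nonneg _
    have h4 : Eᵀ *ᵥ y = 0 := dotProduct_self_eq_zero.1 (by linarith)
    have h5 : Uᵀ *ᵥ y = 0 := dotProduct_self_eq_zero.1 (by linarith)
    have h6 : y ∈ LinearMap.ker Eᵀ.mulVecLin := h4
    rw [← hU.span_eq, ← range_mulVecLin] at h6
    obtain ⟨h, rfl⟩ := h6
    apply hy
    apply dotProduct_self_eq_zero.1
    rw [mulVecLin_apply] at h5 ⊢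
    rw [dotProduct_mulVec, ← mulVec_transpose, h5, zero_dotProduct]
  refine ⟨Eᵀ * Q⁻¹, Q⁻¹ * U, ?_⟩
  have hcomm : Q * (U * Uᵀ) = U * Uᵀ * Q := by
    rw [hQ, Matrix.add_mul, Matrix.mul_add, ← Matrix.mul_assoc (E * Eᵀ), Matrix.mul_assoc E, hEU,
      ← Matrix.mul_assoc (U * Uᵀ) E, Matrix.mul_assoc U Uᵀ E, hUE]
    simp
  have h7 : Q⁻¹ * (U * Uᵀ) = U * Uᵀ * Q⁻¹ := by
    calc Q⁻¹ * (U * Uᵀ) = Q⁻¹ * (U * Uᵀ * Q) * Q⁻¹ := by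
          rw [Matrix.mul_assoc, Matrix.mul_assoc, mul_nonsing_inv _ hdet, Matrix.mul_one]
      _ = U * Uᵀ * Q⁻¹ := by
          rw [← hcomm, ← Matrix.mul_assoc, nonsing_inv_mul _ hdet, Matrix.one_mul]
  rw [Matrix.mul_assoc Q⁻¹, h7, ← Matrix.mul_assoc, ← Matrix.add_mul, ← hQ, mul_nonsing_inv _ hdet]

/-- An approximate right inverse of the pencil `z E - A`, with `P = V (L A V)⁻¹ L` in the role of
the limit of `-(z E - A)⁻¹` as `|z| → ∞`. The correction `G (1 - A P)` is chosen such that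
multiplication by `E` gives `1 - A P`, which is possible because `L (1 - A P) = 0`. -/
theorem pencil_mul_eq {n ν : ℕ} {E A G : Matrix (Fin n) (Fin n) ℂ}
    {L : Matrix (Fin ν) (Fin n) ℂ} {V W : Matrix (Fin n) (Fin ν) ℂ} (hEV : E * V = 0)
    (hEG : E * G + W * L = 1) (hD : IsUnit (L * A * V)) {z : ℂ} (hz : z ≠ 0) :
    (z • E - A) * (-(V * (L * A * V)⁻¹ * L) + z⁻¹ • (G * (1 - A * (V * (L * A * V)⁻¹ * L)))) =
      1 - z⁻¹ • (A * (G * (1 - A * (V * (L * A * V)⁻¹ * L)))) := by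
  set P := V * (L * A * V)⁻¹ * L with hP
  have hEP : E * P = 0 := by rw [hP, ← Matrix.mul_assoc, ← Matrix.mul_assoc, hEV]; simp
  have hLP : L * (1 - A * P) = 0 := by
    have : L * (A * P) = (L * A * V) * (L * A * V)⁻¹ * L := by rw [hP]; simp only [Matrix.mul_assoc]
    rw [Matrix.mul_sub, this, mul_nonsing_inv _ ((isUnit_iff_isUnit_det _).1 hD)]
    simp
  have hY : E * (G * (1 - A * P)) = 1 - A * P := by
    rw [← Matrix.mul_assoc, eq_sub_of_add_eq hEG, Matrix.sub_mul, Matrix.mul_assoc, hLP]; simp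
  rw [Matrix.sub_mul, Matrix.mul_add, Matrix.mul_add, Matrix.mul_neg, Matrix.mul_neg, Matrix.smul_mul,
    Matrix.smul_mul, hEP, Matrix.mul_smul, Matrix.mul_smul, hY, smul_smul, mul_inv_cancel₀ hz]
  simp only [smul_zero, neg_zero, one_smul]
  abel

/-- Quantitative convergence of `(z E - A)⁻¹` to `-V (L A V)⁻¹ L` as `|z| → ∞`. The constants depend
only on bounds for norms, hence are uniform over compact sets of matrices `A`. -/
theorem pencil_inv_add_le {n ν : ℕ} {E A G : Matrix (Fin n) (Fin n) ℂ}
    {L : Matrix (Fin ν) (Fin n) ℂ} {V W : Matrix (Fin n) (Fin ν) ℂ} (hEV : E * V = 0)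
    (hEG : E * G + W * L = 1) (hD : IsUnit (L * A * V)) {a b : ℝ}
    (ha : ‖V * (L * A * V)⁻¹ * L‖ ≤ a)
    (hb : ‖G * (1 - A * (V * (L * A * V)⁻¹ * L))‖ ≤ b)
    (hab : ‖A‖ ≤ a) {z : ℂ} (hz1 : 1 ≤ ‖z‖) (hz : 2 * (a * b) ≤ ‖z‖) :
    IsUnit (z • E - A) ∧
      ‖(z • E - A)⁻¹ + V * (L * A * V)⁻¹ * L‖ ≤ (b + 2 * (a + b) * (a * b)) / ‖z‖ := by
  have hz0 : 0 < ‖z‖ := by linarith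
  have hmul := pencil_mul_eq hEV hEG hD (norm_pos_iff.1 hz0)
  set P := V * (L * A * V)⁻¹ * L with hP
  set Y := G * (1 - A * P) with hY
  have ha0 : 0 ≤ a := (norm_nonneg _).trans ha
  have hb0 : 0 ≤ b := (norm_nonneg _).trans hb
  have hAY : ‖A * Y‖ ≤ a * b := (l2_opNorm_mul A Y).trans (by gcongr)
  have hsm : ‖z⁻¹ • (A * Y)‖ ≤ 1 / 2 := by
    rw [norm_smul, norm_inv, inv_mul_le_iff₀ hz0]; linarith
  have hR : IsUnit (1 - z⁻¹ • (A * Y)) := isUnit_one_sub_of_norm_lt_one (by linarith)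
  have hunit : IsUnit (z • E - A) := by
    rw [isUnit_iff_isUnit_det] at hR ⊢
    rw [← hmul, det_mul] at hR
    exact isUnit_of_mul_isUnit_left hR
  refine ⟨hunit, ?_⟩
  set X := (z • E - A)⁻¹ with hX
  -- The identity for the approximate inverse, multiplied by `X`; it contains `X` on both sides,
  -- but with a factor of size at most `1 / 2` on the right.
  have hXP : X + P = z⁻¹ • Y + z⁻¹ • (X * (A * Y)) := by
    have := congrArg (X * ·) hmul
    rw [← Matrix.mul_assoc, hX, nonsing_inv_mul _ ((isUnit_iff_isUnit_det _).1 hunit), ← hX,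
      Matrix.one_mul, Matrix.mul_sub, Matrix.mul_one, Matrix.mul_smul] at this
    rw [eq_sub_iff_add_eq] at this
    nth_rewrite 1 [← this]
    abel
  have h1 : ‖X + P‖ ≤ ‖z‖⁻¹ * b + ‖z‖⁻¹ * (‖X‖ * (a * b)) := by
    rw [hXP]
    refine (norm_add_le _ _).trans ?_
    rw [norm_smul, norm_smul, norm_inv]
    gcongr
    exact (l2_opNorm_mul _ _).trans (by gcongr)
  have hinv1 : ‖z‖⁻¹ ≤ 1 := inv_le_one_of_one_le₀ hz1
  have hinv2 : ‖z‖⁻¹ * (a * b) ≤ 1 / 2 := by rw [inv_mul_le_iff₀ hz0]; linarith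
  have hXn : ‖X‖ ≤ 2 * (a + b) := by
    have h2 : ‖X‖ ≤ ‖X + P‖ + ‖P‖ := by simpa using norm_sub_le (X + P) P
    have h3 : ‖z‖⁻¹ * b ≤ b := mul_le_of_le_one_left hb0 hinv1
    have h4 : ‖z‖⁻¹ * (‖X‖ * (a * b)) ≤ ‖X‖ * (1 / 2) := by
      rw [mul_left_comm]; gcongr
    linarith
  calc ‖X + P‖ ≤ ‖z‖⁻¹ * b + ‖z‖⁻¹ * (‖X‖ * (a * b)) := h1
    _ ≤ ‖z‖⁻¹ * b + ‖z‖⁻¹ * (2 * (a + b) * (a * b)) := by gcongr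
    _ = _ := by rw [← mul_add, div_eq_inv_mul]

namespace DDAE

variable {n m p q ν : ℕ}

/-! ### Exponential stability and characteristic roots -/

/-- A null vector `v` of the characteristic matrix at `z` gives the complex solution `e^{z t} v`;
the map `φ` is used to pass to its real and imaginary parts. -/
theorem isSolution_of_charMatrix_mulVec_eq_zero (S : DDAE n m p q) {r : EuclideanSpace ℝ (Fin m)}
    {z : ℂ} {v : Fin n → ℂ} (hv : S.charMatrix r z *ᵥ v = 0) (φ : ℂ →L[ℝ] ℝ) :
    S.IsSolution r (fun t i => φ (Complex.exp (z * t) * v i)) := by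
  refine ⟨by fun_prop, fun t _ => HasDerivAt.hasDerivWithinAt ?_⟩
  rw [hasDerivAt_pi]
  intro i
  have hchar : z • (S.E.map Complex.ofReal *ᵥ v) = S.A₀.map Complex.ofReal *ᵥ v +
      ∑ k, Complex.exp (-(z * (r k : ℂ))) • ((S.A k).map Complex.ofReal *ᵥ v) := by
    rw [charMatrix, sub_mulVec, sub_mulVec, smul_mulVec, sum_mulVec, sub_sub, sub_eq_zero] at hv
    simpa only [smul_mulVec] using hv
  have hexp (M : Matrix (Fin n) (Fin n) ℝ) (s : ℝ) :
      (M *ᵥ fun j => φ (Complex.exp (z * s) * v j)) i =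
        φ (Complex.exp (z * s) * (M.map Complex.ofReal *ᵥ v) i) := by
    rw [map_mulVec_ofReal]
    congr 1
    have : (fun j => Complex.exp (z * s) * v j) = Complex.exp (z * s) • v := rfl
    rw [this, mulVec_smul]; rfl
  simp only [hexp, Pi.add_apply, Finset.sum_apply]
  have hd : HasDerivAt (fun s : ℝ => Complex.exp (z * s) * (S.E.map Complex.ofReal *ᵥ v) i)
      (Complex.exp (z * t) * z * (S.E.map Complex.ofReal *ᵥ v) i) t := by
    have h1 : HasDerivAt (fun s : ℝ => z * (s : ℂ)) z t := by
      simpa using (Complex.ofRealCLM.hasDerivAt (x := t)).const_mul z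
    exact h1.cexp.mul_const _
  refine (φ.hasFDerivAt.comp_hasDerivAt t hd).congr_deriv ?_
  rw [← map_sum, ← map_add]
  congr 1
  have := congrFun hchar i
  simp only [Pi.smul_apply, Pi.add_apply, Finset.sum_apply, smul_eq_mul] at this
  rw [mul_assoc, this, mul_add, Finset.mul_sum]
  congr 1
  refine Finset.sum_congr rfl fun k _ => ?_
  rw [← mul_assoc, ← Complex.exp_add]
  push_cast
  ring_nf

/-- Exponential stability with rate `α` excludes characteristic roots `z` with `Re z > -α`, as the
exponential solutions that they generate decay too slowly. -/
theorem IsExpStable.exists_forall_isUnit_charMatrix {S : DDAE n m p q}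
    {r : EuclideanSpace ℝ (Fin m)} (h : S.IsExpStable r) :
    ∃ α : ℝ, 0 < α ∧ ∀ z : ℂ, -α < z.re → IsUnit (S.charMatrix r z) := by
  obtain ⟨K, α, hα, hK⟩ := h
  refine ⟨α, hα, fun z hz => ?_⟩
  rw [isUnit_iff_isUnit_det, isUnit_iff_ne_zero]
  intro h0
  obtain ⟨v, hv, hzv⟩ := exists_mulVec_eq_zero_iff.2 h0
  obtain ⟨j, hj⟩ := Function.ne_iff.1 hv
  have hbound (φ : ℂ →L[ℝ] ℝ) : ∃ M : ℝ, ∀ t : ℝ, 0 ≤ t →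
      |φ (Complex.exp (z * t) * v j)| ≤ K * Real.exp (-α * t) * M := by
    have hsol := S.isSolution_of_charMatrix_mulVec_eq_zero hzv φ
    obtain ⟨M, hM⟩ := (isCompact_Icc (a := -(⨆ i, r i)) (b := 0)).exists_bound_of_continuousOn
      (hsol.continuousOn.mono Icc_subset_Ici_self)
    exact ⟨M, fun t ht => (norm_le_pi_norm (fun i => φ (Complex.exp (z * t) * v i)) j).trans
      (hK _ hsol M hM t ht)⟩
  obtain ⟨M₁, h₁⟩ := hbound Complex.reCLM
  obtain ⟨M₂, h₂⟩ := hbound Complex.imCLM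
  have hj' : 0 < ‖v j‖ := norm_pos_iff.2 hj
  have hβ : 0 < z.re + α := by linarith
  -- Compare `e^{t Re z}` with `e^{-α t}`, through `x + 1 ≤ e^x`.
  have hgrow (t : ℝ) (ht : 0 ≤ t) : ((z.re + α) * t + 1) * ‖v j‖ ≤ K * (M₁ + M₂) := by
    have h3 : Real.exp (z.re * t) * ‖v j‖ ≤ K * Real.exp (-α * t) * (M₁ + M₂) := by
      have h4 : ‖Complex.exp (z * t) * v j‖ = Real.exp (z.re * t) * ‖v j‖ := by
        rw [norm_mul, Complex.norm_exp]; simp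
      rw [← h4, mul_add]
      exact (Complex.norm_le_abs_re_add_abs_im _).trans (add_le_add (h₁ t ht) (h₂ t ht))
    have h5 : Real.exp ((z.re + α) * t) = Real.exp (α * t) * Real.exp (z.re * t) := by
      rw [← Real.exp_add]; ring_nf
    have h6 : Real.exp (α * t) * Real.exp (-α * t) = 1 := by
      rw [← Real.exp_add]; simp
    calc ((z.re + α) * t + 1) * ‖v j‖ ≤ Real.exp ((z.re + α) * t) * ‖v j‖ := by
          gcongr; exact Real.add_one_le_exp _
      _ = Real.exp (α * t) * (Real.exp (z.re * t) * ‖v j‖) := by rw [h5, mul_assoc]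
      _ ≤ Real.exp (α * t) * (K * Real.exp (-α * t) * (M₁ + M₂)) := by gcongr
      _ = K * (M₁ + M₂) := by linear_combination (K * (M₁ + M₂)) * h6
  set B := K * (M₁ + M₂)
  have := hgrow (|B| / ‖v j‖ / (z.re + α)) (by positivity)
  rw [mul_div_cancel₀ _ hβ.ne', add_mul, div_mul_cancel₀ _ hj'.ne'] at this
  linarith [le_abs_self B]

/-! ### Phases of the delayed terms -/

/-- At a sufficiently high frequency, every point of the torus is the vector of factors
`e^{-iω r i}` for positive delays `r` arbitrarily close to `τ`: the phases `ω τ i` have to be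
changed by at most `2π`, so the delays by at most `2π / ω`. -/
theorem exists_mem_ball_exp_eq {τ : EuclideanSpace ℝ (Fin m)} (hτ : ∀ i, 0 < τ i)
    {s : Fin m → ℂ} (hs : ∀ i, ‖s i‖ = 1) {ε : ℝ} (hε : 0 < ε) (Ω : ℝ) :
    ∃ ω : ℝ, Ω ≤ ω ∧ 0 < ω ∧ ∃ r ∈ Metric.ball τ ε, (∀ i, 0 < r i) ∧
      (fun i => Complex.exp (-(ω * Complex.I * (r i : ℂ)))) = s := by
  let r (ω : ℝ) : EuclideanSpace ℝ (Fin m) := WithLp.toLp 2 fun i =>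
    (2 * Real.pi * ⌊(ω * τ i + (s i).arg) / (2 * Real.pi)⌋ - (s i).arg) / ω
  have hr : Tendsto r atTop (𝓝 τ) := by
    have h1 : Tendsto (fun ω => (r ω).ofLp) atTop (𝓝 τ.ofLp) := by
      rw [tendsto_pi_nhds]
      intro i
      rw [tendsto_iff_norm_sub_tendsto_zero]
      refine squeeze_zero' (Eventually.of_forall fun _ => norm_nonneg _) ?_
        (tendsto_const_nhds (x := 2 * Real.pi).div_atTop tendsto_id)
      filter_upwards [eventually_gt_atTop 0] with ω hω
      have hpi := Real.two_pi_pos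
      have h2 : (r ω).ofLp i - τ i =
          -(2 * Real.pi * Int.fract ((ω * τ i + (s i).arg) / (2 * Real.pi))) / ω := by
        rw [Int.fract]
        simp only [r]
        field_simp
        ring
      rw [h2, norm_div, norm_neg, Real.norm_of_nonneg hω.le,
        Real.norm_of_nonneg (mul_nonneg hpi.le (Int.fract_nonneg _))]
      simp only [id]
      exact div_le_div_of_nonneg_right
        (mul_le_of_le_one_right hpi.le (Int.fract_lt_one _).le) hω.le
    exact ((PiLp.continuous_toLp 2 _).tendsto _).comp h1
  have hpos : ∀ᶠ r' in 𝓝 τ, ∀ i, 0 < r' i := by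
    rw [eventually_all]
    intro i
    exact (Continuous.tendsto (by fun_prop : Continuous fun r' : EuclideanSpace ℝ (Fin m) => r' i)
      τ).eventually_const_lt (hτ i)
  obtain ⟨ω, h1, h2, h3, h4⟩ := ((hr.eventually (Metric.ball_mem_nhds τ hε)).and
    ((hr.eventually hpos).and ((eventually_ge_atTop Ω).and (eventually_gt_atTop 0)))).exists
  refine ⟨ω, h3, h4, r ω, h1, h2, funext fun i => ?_⟩
  have h5 : -(ω * Complex.I * ((r ω i : ℝ) : ℂ)) = (s i).arg * Complex.I +
      ((-⌊(ω * τ i + (s i).arg) / (2 * Real.pi)⌋ : ℤ) : ℂ) * (2 * Real.pi * Complex.I) := by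
    have : (ω : ℂ) ≠ 0 := by exact_mod_cast h4.ne'
    simp only [r]
    push_cast
    field_simp
    ring
  rw [h5, Complex.exp_periodic.int_mul]
  have := Complex.norm_mul_exp_arg_mul_I (s i)
  rwa [hs i, Complex.ofReal_one, one_mul] at this

/-- Recurrence of the factors `e^{-iω r i}`: they simultaneously come back close to `1` at
arbitrarily high frequencies. -/
theorem exists_norm_exp_sub_one_lt (r : EuclideanSpace ℝ (Fin m)) {N δ : ℝ} (hN : 0 ≤ N)
    (hδ : 0 < δ) :
    ∃ ω : ℝ, N ≤ ω ∧ ∀ i, ‖Complex.exp (-(ω * Complex.I * (r i : ℂ))) - 1‖ < δ := by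
  let u (k : ℕ) : Fin m → ℂ := fun i => Complex.exp (-((k * N : ℝ) * Complex.I * (r i : ℂ)))
  have hnorm (k : ℕ) (i : Fin m) : ‖u k i‖ = 1 := by
    simp [u, Complex.norm_exp]
  have hK : IsCompact (univ.pi fun _ : Fin m => Metric.sphere (0 : ℂ) 1) :=
    isCompact_univ_pi fun _ => isCompact_sphere 0 1
  obtain ⟨a, -, φ, hφ, hlim⟩ := hK.tendsto_subseq (x := u) fun k i _ => by simp [hnorm]
  obtain ⟨k, hk⟩ := Metric.cauchySeq_iff'.1 hlim.cauchySeq δ hδ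
  have hlt : φ k < φ (k + 1) := hφ k.lt_succ_self
  have h1 : ((φ k : ℝ) + 1) ≤ φ (k + 1) := by exact_mod_cast hlt
  refine ⟨(φ (k + 1) - φ k) * N, le_mul_of_one_le_left hN (by linarith), fun i => ?_⟩
  have h2 : Complex.exp (-(((φ (k + 1) - φ k) * N : ℝ) * Complex.I * (r i : ℂ))) * u (φ k) i =
      u (φ (k + 1)) i := by
    simp only [u]
    rw [← Complex.exp_add]
    push_cast
    ring_nf
  calc _ = ‖(Complex.exp (-(((φ (k + 1) - φ k) * N : ℝ) * Complex.I * (r i : ℂ))) - 1) *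
        u (φ k) i‖ := by rw [norm_mul, hnorm, mul_one]
    _ = dist (u (φ (k + 1)) i) (u (φ k) i) := by rw [sub_mul, h2, one_mul, dist_eq_norm]
    _ ≤ dist (u (φ (k + 1))) (u (φ k)) := dist_le_pi_dist _ _ i
    _ < δ := hk (k + 1) (Nat.le_succ k)

/-! ### The system with the exponentials replaced by free parameters -/

/-- The vector of the factors `e^{-z r i}` by which the delays act on exponential solutions. -/
noncomputable def delayFactors (r : EuclideanSpace ℝ (Fin m)) (z : ℂ) : Fin m → ℂ :=
  fun i => Complex.exp (-(z * (r i : ℂ)))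

/-- The matrix `A₀ + ∑ i, s i A i`, in which the factors `e^{-z r i}` are replaced by free complex
parameters `s i`. -/
noncomputable def stateMatrix (S : DDAE n m p q) (s : Fin m → ℂ) : Matrix (Fin n) (Fin n) ℂ :=
  S.A₀.map Complex.ofReal + ∑ i, s i • (S.A i).map Complex.ofReal

/-- The matrix `Uᵀ (A₀ + ∑ i, s i A i) V` of the algebraic part of the system. -/
noncomputable def reducedMatrix (S : DDAE n m p q) (U V : Matrix (Fin n) (Fin ν) ℝ)
    (s : Fin m → ℂ) : Matrix (Fin ν) (Fin ν) ℂ :=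
  (U.map Complex.ofReal)ᵀ * S.stateMatrix s * V.map Complex.ofReal

/-- The matrix `V (Uᵀ (A₀ + ∑ i, s i A i) V)⁻¹ Uᵀ`. The inverse of `z E - A₀ - ∑ i, s i A i` tends to
its negative as `|z| → ∞`. The value is meaningful only where `reducedMatrix` is invertible. -/
noncomputable def limitResolvent (S : DDAE n m p q) (U V : Matrix (Fin n) (Fin ν) ℝ)
    (s : Fin m → ℂ) : Matrix (Fin n) (Fin n) ℂ :=
  V.map Complex.ofReal * (S.reducedMatrix U V s)⁻¹ * (U.map Complex.ofReal)ᵀ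

theorem norm_delayFactors_apply (r : EuclideanSpace ℝ (Fin m)) (ω : ℝ) (i : Fin m) :
    ‖delayFactors r (ω * Complex.I) i‖ = 1 := by
  simp [delayFactors, Complex.norm_exp]

theorem delayFactors_add (r : EuclideanSpace ℝ (Fin m)) (z w : ℂ) :
    delayFactors r (z + w) = delayFactors r z * delayFactors r w := by
  ext i
  simp only [delayFactors, Pi.mul_apply]
  rw [← Complex.exp_add]
  ring_nf

theorem charMatrix_eq (S : DDAE n m p q) (r : EuclideanSpace ℝ (Fin m)) (z : ℂ) :
    S.charMatrix r z = z • S.E.map Complex.ofReal - S.stateMatrix (delayFactors r z) := by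
  rw [charMatrix, stateMatrix, sub_sub]; rfl

theorem algebraicMatrix_eq (S : DDAE n m p q) (U V : Matrix (Fin n) (Fin ν) ℝ)
    (r : EuclideanSpace ℝ (Fin m)) (z : ℂ) :
    S.algebraicMatrix U V r z = S.reducedMatrix U V (delayFactors r z) := by
  simp only [algebraicMatrix, reducedMatrix, stateMatrix, map_ofReal_mul, Matrix.mul_add,
    Matrix.add_mul, Matrix.mul_sum, Matrix.sum_mul, Matrix.mul_smul, Matrix.smul_mul,
    transpose_map, delayFactors]

theorem asymptoticTransferFunction_eq (S : DDAE n m p q) (U V : Matrix (Fin n) (Fin ν) ℝ)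
    (r : EuclideanSpace ℝ (Fin m)) (z : ℂ) :
    S.asymptoticTransferFunction U V r z = -(S.C.map Complex.ofReal *
      S.limitResolvent U V (delayFactors r z) * S.B.map Complex.ofReal) := by
  simp only [asymptoticTransferFunction, limitResolvent, algebraicMatrix_eq, map_ofReal_mul,
    Matrix.mul_assoc, transpose_map]

theorem continuous_stateMatrix (S : DDAE n m p q) : Continuous S.stateMatrix := by
  unfold stateMatrix
  fun_prop

theorem continuous_reducedMatrix (S : DDAE n m p q) (U V : Matrix (Fin n) (Fin ν) ℝ) :
    Continuous (S.reducedMatrix U V) := by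
  have := S.continuous_stateMatrix
  unfold reducedMatrix
  fun_prop

theorem isOpen_isUnit_reducedMatrix (S : DDAE n m p q) (U V : Matrix (Fin n) (Fin ν) ℝ) :
    IsOpen {s | IsUnit (S.reducedMatrix U V s)} :=
  Units.isOpen.preimage (S.continuous_reducedMatrix U V)

theorem continuousOn_limitResolvent (S : DDAE n m p q) (U V : Matrix (Fin n) (Fin ν) ℝ)
    {K : Set (Fin m → ℂ)} (hK : ∀ s ∈ K, IsUnit (S.reducedMatrix U V s)) :
    ContinuousOn (S.limitResolvent U V) K := by
  have h : ContinuousOn (fun s => (S.reducedMatrix U V s)⁻¹) K := fun s hs =>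
    (ContinuousAt.comp (f := S.reducedMatrix U V) (Matrix.continuousAt_inv (hK s hs))
      (S.continuous_reducedMatrix U V).continuousAt).continuousWithinAt
  unfold limitResolvent
  rw [continuousOn_iff_continuous_domRestrict] at h ⊢
  exact (continuous_const.matrix_mul h).matrix_mul continuous_const

theorem exists_mul_add_mul_eq_one {S : DDAE n m p q} {U : Matrix (Fin n) (Fin ν) ℝ}
    (hU : IsNullspaceBasis S.Eᵀ U) :
    ∃ (G : Matrix (Fin n) (Fin n) ℂ) (W : Matrix (Fin n) (Fin ν) ℂ),
      S.E.map Complex.ofReal * G + W * (U.map Complex.ofReal)ᵀ = 1 := by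
  obtain ⟨G, W, h⟩ := hU.exists_mul_add_mul_transpose_eq_one
  refine ⟨G.map Complex.ofReal, W.map Complex.ofReal, ?_⟩
  rw [← transpose_map, ← map_ofReal_mul, ← map_ofReal_mul, ← Matrix.map_add _ Complex.ofReal_add,
    h, map_ofReal_one]

theorem map_E_mul_map_V {S : DDAE n m p q} {V : Matrix (Fin n) (Fin ν) ℝ}
    (hV : IsNullspaceBasis S.E V) : S.E.map Complex.ofReal * V.map Complex.ofReal = 0 := by
  have : S.E * V = 0 := by
    ext i j
    have h : V.col j ∈ LinearMap.ker S.E.mulVecLin := by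
      rw [← hV.span_eq]; exact Submodule.subset_span ⟨j, rfl⟩
    exact congrFun (LinearMap.mem_ker.1 h) i
  rw [← map_ofReal_mul, this]
  ext; simp

/-- High frequency behaviour of the inverse of the characteristic matrix, uniformly for factors `s`
in a compact set on which the algebraic part is nonsingular. -/
theorem exists_forall_norm_inv_add_limitResolvent_le {S : DDAE n m p q}
    {U V : Matrix (Fin n) (Fin ν) ℝ} (hU : IsNullspaceBasis S.Eᵀ U) (hV : IsNullspaceBasis S.E V)
    {K : Set (Fin m → ℂ)} (hK : IsCompact K) (hD : ∀ s ∈ K, IsUnit (S.reducedMatrix U V s)) :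
    ∃ c R : ℝ, 0 ≤ c ∧ 1 ≤ R ∧ ∀ s ∈ K, ‖S.limitResolvent U V s‖ ≤ c ∧ ∀ z : ℂ, R ≤ ‖z‖ →
      IsUnit (z • S.E.map Complex.ofReal - S.stateMatrix s) ∧
      ‖(z • S.E.map Complex.ofReal - S.stateMatrix s)⁻¹ + S.limitResolvent U V s‖ ≤ c / ‖z‖ := by
  obtain ⟨G, W, hGW⟩ := exists_mul_add_mul_eq_one hU
  have hP := S.continuousOn_limitResolvent U V hD
  have hA := S.continuous_stateMatrix.continuousOn (s := K)
  obtain ⟨a₁, ha₁⟩ := hK.exists_bound_of_continuousOn hP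
  obtain ⟨a₂, ha₂⟩ := hK.exists_bound_of_continuousOn hA
  obtain ⟨b, hb⟩ := hK.exists_bound_of_continuousOn
    (f := fun s => G * (1 - S.stateMatrix s * S.limitResolvent U V s))
    (continuousOn_const.mul (continuousOn_const.sub (hA.mul hP)))
  set a := max a₁ a₂
  refine ⟨max 0 (max a₁ (b + 2 * (a + b) * (a * b))), max 1 (2 * (a * b)), le_max_left _ _,
    le_max_left _ _, fun s hs => ⟨(ha₁ s hs).trans (le_max_of_le_right (le_max_left _ _)),
    fun z hz => ?_⟩⟩
  obtain ⟨h1, h2⟩ := pencil_inv_add_le (map_E_mul_map_V hV) hGW (hD s hs) (a := a) (b := b)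
    ((ha₁ s hs).trans (le_max_left _ _)) (hb s hs) ((ha₂ s hs).trans (le_max_right _ _))
    ((le_max_left _ _).trans hz) ((le_max_right _ _).trans hz)
  refine ⟨h1, h2.trans ?_⟩
  gcongr
  exact le_max_of_le_right (le_max_right _ _)

theorem differentiable_delayFactors (r : EuclideanSpace ℝ (Fin m)) :
    Differentiable ℂ (delayFactors r) := by
  unfold delayFactors
  fun_prop

theorem differentiable_stateMatrix (S : DDAE n m p q) : Differentiable ℂ S.stateMatrix := by
  unfold stateMatrix
  fun_prop

theorem differentiable_charMatrix (S : DDAE n m p q) (r : EuclideanSpace ℝ (Fin m)) :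
    Differentiable ℂ (S.charMatrix r) := by
  have : S.charMatrix r = fun z => z • S.E.map Complex.ofReal - S.stateMatrix (delayFactors r z) :=
    funext (S.charMatrix_eq r)
  rw [this]
  exact (differentiable_id.smul_const _).sub
    (S.differentiable_stateMatrix.comp (differentiable_delayFactors r))

theorem differentiableAt_inv_charMatrix (S : DDAE n m p q) {r : EuclideanSpace ℝ (Fin m)} {z : ℂ}
    (hz : IsUnit (S.charMatrix r z)) : DifferentiableAt ℂ (fun z => (S.charMatrix r z)⁻¹) z := by
  simp only [nonsing_inv_eq_ringInverse]
  exact DifferentiableAt.comp (g := Ring.inverse) z (differentiableAt_inverse hz)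
    (S.differentiable_charMatrix r z)

theorem differentiable_det_reducedMatrix (S : DDAE n m p q) (U V : Matrix (Fin n) (Fin ν) ℝ)
    (r : EuclideanSpace ℝ (Fin m)) :
    Differentiable ℂ (fun z => (S.reducedMatrix U V (delayFactors r z)).det) := by
  have hentry (i j) : Differentiable ℂ fun z => S.reducedMatrix U V (delayFactors r z) i j := by
    simp only [reducedMatrix, stateMatrix, Matrix.mul_apply, Matrix.add_apply, Matrix.sum_apply,
      Matrix.smul_apply, delayFactors]
    fun_prop
  simp only [det_apply]
  exact Differentiable.fun_sum fun σ _ =>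
    (Differentiable.fun_finsetProd fun i _ => hentry _ _).const_smul _

theorem reducedMatrix_zero (S : DDAE n m p q) (U V : Matrix (Fin n) (Fin ν) ℝ) :
    S.reducedMatrix U V 0 = (Uᵀ * S.A₀ * V).map Complex.ofReal := by
  simp [reducedMatrix, stateMatrix, map_ofReal_mul, transpose_map]

theorem isUnit_reducedMatrix_zero {S : DDAE n m p q} {U V : Matrix (Fin n) (Fin ν) ℝ}
    (hA₀ : IsUnit (Uᵀ * S.A₀ * V).det) : IsUnit (S.reducedMatrix U V 0) := by
  rw [reducedMatrix_zero]
  exact ((isUnit_iff_isUnit_det _).2 hA₀).map (Complex.ofRealHom.mapMatrix (m := Fin ν))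

/-- For fixed positive delays the algebraic part is singular only on a discrete set: its determinant
is an entire function of `z` which does not vanish identically, since it tends to the determinant of
`Uᵀ A₀ V` as `z → +∞` along the reals. -/
theorem eventually_isUnit_reducedMatrix {S : DDAE n m p q} {U V : Matrix (Fin n) (Fin ν) ℝ}
    (hA₀ : IsUnit (Uᵀ * S.A₀ * V).det) {r : EuclideanSpace ℝ (Fin m)} (hr : ∀ i, 0 < r i) (z₀ : ℂ) :
    ∀ᶠ z in 𝓝[≠] z₀, IsUnit (S.reducedMatrix U V (delayFactors r z)) := by
  have hd := S.differentiable_det_reducedMatrix U V r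
  rcases (hd.analyticAt z₀).eventually_eq_zero_or_eventually_ne_zero with h | h
  · exfalso
    have hzero := AnalyticOnNhd.eqOn_zero_of_preconnected_of_eventuallyEq_zero
      (fun z _ => hd.analyticAt z) isPreconnected_univ (mem_univ z₀) h
    have hlim : Tendsto (fun x : ℝ => delayFactors r x) atTop (𝓝 0) := by
      rw [tendsto_pi_nhds]
      intro i
      simp only [delayFactors, Pi.zero_apply]
      rw [tendsto_zero_iff_norm_tendsto_zero]
      simp only [Complex.norm_exp]
      have : Tendsto (fun x : ℝ => x * r i) atTop atTop :=
        tendsto_id.atTop_mul_const (hr i)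
      convert Real.tendsto_exp_neg_atTop_nhds_zero.comp this using 2 with x
      simp
    have h1 : Tendsto (fun x : ℝ => (S.reducedMatrix U V (delayFactors r x)).det) atTop
        (𝓝 (S.reducedMatrix U V 0).det) :=
      ((S.continuous_reducedMatrix U V).matrix_det.tendsto 0).comp hlim
    have h2 : (fun x : ℝ => (S.reducedMatrix U V (delayFactors r x)).det) = fun _ => 0 :=
      funext fun x => hzero (mem_univ (x : ℂ))
    rw [h2] at h1
    have h3 := (isUnit_iff_isUnit_det _).1 (isUnit_reducedMatrix_zero hA₀)
    rw [← tendsto_nhds_unique tendsto_const_nhds h1] at h3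
    exact not_isUnit_zero h3
  · filter_upwards [h] with z hz
    rw [isUnit_iff_isUnit_det, isUnit_iff_ne_zero]
    exact hz

/-! ### Strong stability of the algebraic part -/

/-- If the characteristic matrix is invertible on `Re z > -α`, its inverse is bounded at the points
`i(ω + ω')` for all large `ω'` for which the factors `e^{-iω' r i}` are close to `1`, even if the
algebraic part is singular at `iω`. The bound comes from a circle around `i(ω + ω')` and the
maximum modulus principle. -/
theorem exists_norm_inv_charMatrix_le {S : DDAE n m p q}
    {U V : Matrix (Fin n) (Fin ν) ℝ} (hU : IsNullspaceBasis S.Eᵀ U) (hV : IsNullspaceBasis S.E V)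
    (hA₀ : IsUnit (Uᵀ * S.A₀ * V).det) {r : EuclideanSpace ℝ (Fin m)} (hr : ∀ i, 0 < r i)
    {α : ℝ} (hα : 0 < α) (hS : ∀ z : ℂ, -α < z.re → IsUnit (S.charMatrix r z)) (ω : ℝ) :
    ∃ δ M R : ℝ, 0 < δ ∧ ∀ ω' : ℝ, R ≤ ω' →
      (∀ i, ‖delayFactors r (ω' * Complex.I) i - 1‖ < δ) →
      ‖(S.charMatrix r (ω * Complex.I + ω' * Complex.I))⁻¹‖ ≤ M := by
  set z₀ : ℂ := ω * Complex.I
  obtain ⟨ε, hε, hball⟩ := Metric.mem_nhdsWithin_iff.1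
    (eventually_isUnit_reducedMatrix hA₀ hr z₀ : {z | _} ∈ _)
  obtain ⟨ρ, hρ, hρlt⟩ := exists_between (lt_min hε hα)
  have hρε := hρlt.trans_le (min_le_left _ _)
  have hρα := hρlt.trans_le (min_le_right _ _)
  have hcont : Continuous (delayFactors r) := (differentiable_delayFactors r).continuous
  -- The algebraic part is nonsingular for factors in `K₀`, hence also in a compact neighbourhood,
  -- which contains the factors on the circle shifted by `iω'`.
  set K₀ := delayFactors r '' Metric.sphere z₀ ρ
  have hK₀ : IsCompact K₀ := (isCompact_sphere z₀ ρ).image hcont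
  have hK₀D : K₀ ⊆ {s | IsUnit (S.reducedMatrix U V s)} := by
    rintro _ ⟨z, hz, rfl⟩
    rw [mem_sphere_iff_norm, ← dist_eq_norm] at hz
    refine hball ⟨?_, ?_⟩
    · rw [Metric.mem_ball, hz]; exact hρε
    · rintro rfl
      rw [dist_self] at hz
      exact hρ.ne hz
  obtain ⟨δ₀, hδ₀, hthick⟩ := hK₀.exists_cthickening_subset_open
    (S.isOpen_isUnit_reducedMatrix U V) hK₀D
  obtain ⟨c, R, hc, hR, hbd⟩ := exists_forall_norm_inv_add_limitResolvent_le hU hV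
    (hK₀.cthickening (r := δ₀)) hthick
  obtain ⟨B, hB⟩ := hK₀.isBounded.exists_norm_le
  have hB1 : 0 < max B 1 := lt_max_of_lt_right one_pos
  refine ⟨δ₀ / max B 1, c + c, R + ρ - ω, by positivity, fun ω' hω' hδ => ?_⟩
  set z₁ : ℂ := z₀ + ω' * Complex.I with hz₁
  have hre (z : ℂ) (hz : z ∈ Metric.closedBall z₁ ρ) : -α < z.re := by
    rw [mem_closedBall_iff_norm] at hz
    have h1 := (Complex.abs_re_le_norm (z - z₁)).trans hz
    have h2 : z₁.re = 0 := by simp [z₁, z₀]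
    rw [Complex.sub_re, h2, sub_zero] at h1
    linarith [neg_abs_le z.re]
  have hdiff : DifferentiableOn ℂ (fun z => (S.charMatrix r z)⁻¹)
      (closure (Metric.ball z₁ ρ)) := fun z hz =>
    (S.differentiableAt_inv_charMatrix (hS z (hre z (Metric.closure_ball_subset_closedBall hz)))
      ).differentiableWithinAt
  refine Complex.norm_le_of_forall_mem_frontier_norm_le Metric.isBounded_ball hdiff.diffContOnCl
    (fun z hz => ?_) (subset_closure (Metric.mem_ball_self hρ))
  rw [frontier_ball _ hρ.ne', mem_sphere_iff_norm] at hz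
  set w := z - ω' * Complex.I with hw
  have hw₀ : w ∈ Metric.sphere z₀ ρ := by
    rw [mem_sphere_iff_norm, ← hz, hw, hz₁]; congr 1; ring
  have hmem : delayFactors r z ∈ Metric.cthickening δ₀ K₀ := by
    refine Metric.mem_cthickening_of_dist_le _ (delayFactors r w) _ _ ⟨w, hw₀, rfl⟩ ?_
    rw [dist_eq_norm, pi_norm_le_iff_of_nonneg hδ₀.le]
    intro i
    have hzw : delayFactors r z i - delayFactors r w i =
        delayFactors r w i * (delayFactors r (ω' * Complex.I) i - 1) := by
      have : z = w + ω' * Complex.I := by rw [hw]; ring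
      rw [this, delayFactors_add, Pi.mul_apply]; ring
    rw [Pi.sub_apply, hzw, norm_mul]
    calc _ ≤ max B 1 * (δ₀ / max B 1) := by
          gcongr
          · exact ((norm_le_pi_norm _ i).trans (hB _ ⟨w, hw₀, rfl⟩)).trans (le_max_left _ _)
          · exact (hδ i).le
      _ = δ₀ := mul_div_cancel₀ _ hB1.ne'
  have hzR : R ≤ ‖z‖ := by
    have h1 := (Complex.abs_im_le_norm (z - z₁)).trans hz.le
    have h2 : z₁.im = ω + ω' := by simp [z₁, z₀]
    rw [Complex.sub_im, h2] at h1
    linarith [neg_abs_le (z.im - (ω + ω')), le_abs_self z.im, Complex.abs_im_le_norm z]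
  obtain ⟨h1, h2⟩ := hbd _ hmem
  obtain ⟨-, h3⟩ := h2 z hzR
  rw [← S.charMatrix_eq] at h3
  have h4 : c / ‖z‖ ≤ c := div_le_self hc (hR.trans hzR)
  calc ‖(S.charMatrix r z)⁻¹‖
      = ‖((S.charMatrix r z)⁻¹ + S.limitResolvent U V (delayFactors r z)) -
          S.limitResolvent U V (delayFactors r z)‖ := by rw [add_sub_cancel_right]
    _ ≤ c + c := (norm_sub_le _ _).trans (add_le_add (h3.trans h4) h1)

/-- A null vector `N` of the algebraic part at `s` gives approximate null vectors of the
characteristic matrix along every sequence `z k → ∞` whose factors tend to `s`. The correction `y`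
with `E y = A(s) V N` exists because `Uᵀ A(s) V N = 0`. Vectors are written as matrices with one
column, so that the matrix norm applies to them. -/
theorem exists_tendsto_charMatrix_mul {S : DDAE n m p q}
    {U V : Matrix (Fin n) (Fin ν) ℝ} (hU : IsNullspaceBasis S.Eᵀ U) (hV : IsNullspaceBasis S.E V)
    {r : EuclideanSpace ℝ (Fin m)} {s : Fin m → ℂ} {N : Matrix (Fin ν) (Fin 1) ℂ}
    (hDN : S.reducedMatrix U V s * N = 0) {z : ℕ → ℂ} (hz0 : ∀ k, z k ≠ 0)
    (hzinv : Tendsto (fun k => (z k)⁻¹) atTop (𝓝 0))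
    (hs : Tendsto (fun k => delayFactors r (z k)) atTop (𝓝 s)) :
    ∃ X : ℕ → Matrix (Fin n) (Fin 1) ℂ, Tendsto X atTop (𝓝 (V.map Complex.ofReal * N)) ∧
      Tendsto (fun k => S.charMatrix r (z k) * X k) atTop (𝓝 0) := by
  obtain ⟨G, W, hGW⟩ := exists_mul_add_mul_eq_one hU
  have hEV : S.E.map Complex.ofReal * (V.map Complex.ofReal * N) = 0 := by
    rw [← Matrix.mul_assoc, map_E_mul_map_V hV, Matrix.zero_mul]
  rw [reducedMatrix, Matrix.mul_assoc, Matrix.mul_assoc] at hDN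
  generalize V.map Complex.ofReal * N = Y at *
  set y := G * (S.stateMatrix s * Y) with hy
  have hEy : S.E.map Complex.ofReal * y = S.stateMatrix s * Y := by
    rw [hy, ← Matrix.mul_assoc, eq_sub_of_add_eq hGW, Matrix.sub_mul, Matrix.mul_assoc, hDN]
    simp
  have hX : Tendsto (fun k => Y + (z k)⁻¹ • y) atTop (𝓝 Y) := by
    simpa using tendsto_const_nhds.add (hzinv.smul_const y)
  refine ⟨fun k => Y + (z k)⁻¹ • y, hX, ?_⟩
  have h1 (k : ℕ) : S.charMatrix r (z k) * (Y + (z k)⁻¹ • y) =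
      S.stateMatrix s * Y - S.stateMatrix (delayFactors r (z k)) * (Y + (z k)⁻¹ • y) := by
    rw [S.charMatrix_eq, Matrix.sub_mul, Matrix.smul_mul, Matrix.mul_add _ Y, hEV,
      Matrix.mul_smul, hEy, zero_add, smul_smul, mul_inv_cancel₀ (hz0 k), one_smul]
  have h2 := Matrix.tendsto_mul ((S.continuous_stateMatrix.tendsto s).comp hs) hX
  simp only [h1]
  simpa using (tendsto_const_nhds (x := S.stateMatrix s * Y)).sub h2

/-- A sequence of frequencies tending to infinity along which the factors tend to their values
at `iω`. -/
theorem exists_seq_delayFactors_tendsto (r : EuclideanSpace ℝ (Fin m)) (ω R : ℝ) {δ : ℝ}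
    (hδ : 0 < δ) :
    ∃ ω' : ℕ → ℝ, (∀ k, R ≤ ω' k) ∧
      (∀ k i, ‖delayFactors r (ω' k * Complex.I) i - 1‖ < δ) ∧
      (∀ k, (ω * Complex.I + ω' k * Complex.I : ℂ) ≠ 0) ∧
      Tendsto (fun k => (ω * Complex.I + ω' k * Complex.I : ℂ)⁻¹) atTop (𝓝 0) ∧
      Tendsto (fun k => delayFactors r (ω * Complex.I + ω' k * Complex.I)) atTop
        (𝓝 (delayFactors r (ω * Complex.I))) := by
  have hfreq (k : ℕ) : ∃ ω' : ℝ, max (max R 0) (k + 1 - ω) ≤ ω' ∧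
      ∀ i, ‖delayFactors r (ω' * Complex.I) i - 1‖ < min δ (1 / (k + 1)) :=
    exists_norm_exp_sub_one_lt r (le_max_of_le_left (le_max_right _ _)) (by positivity)
  choose ω' hω' hphase using hfreq
  have hzk (k : ℕ) : (k : ℝ) + 1 ≤ ‖(ω * Complex.I + ω' k * Complex.I : ℂ)‖ := by
    have := Complex.abs_im_le_norm (ω * Complex.I + ω' k * Complex.I : ℂ)
    have h1 : (ω * Complex.I + ω' k * Complex.I : ℂ).im = ω + ω' k := by simp
    rw [h1] at this
    linarith [le_abs_self (ω + ω' k), (le_max_right _ _).trans (hω' k)]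
  refine ⟨ω', fun k => ((le_max_left _ _).trans (le_max_left _ _)).trans (hω' k),
    fun k i => (hphase k i).trans_le (min_le_left _ _),
    fun k => norm_pos_iff.1 (lt_of_lt_of_le (by positivity) (hzk k)), ?_, ?_⟩
  · rw [tendsto_zero_iff_norm_tendsto_zero]
    refine squeeze_zero (fun _ => norm_nonneg _) (fun k => ?_)
      (tendsto_one_div_add_atTop_nhds_zero_nat (𝕜 := ℝ))
    rw [norm_inv, one_div]
    exact inv_anti₀ (by positivity) (hzk k)
  · rw [tendsto_pi_nhds]
    intro i
    rw [tendsto_iff_norm_sub_tendsto_zero]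
    refine squeeze_zero (fun _ => norm_nonneg _) (fun k => ?_)
      (tendsto_one_div_add_atTop_nhds_zero_nat (𝕜 := ℝ))
    rw [delayFactors_add, Pi.mul_apply, ← mul_sub_one, norm_mul, norm_delayFactors_apply, one_mul]
    exact (hphase k i).le.trans (min_le_right _ _)

/-- Strong exponential stability forces the algebraic part to be nonsingular for all factors on the
torus, that is, uniformly nonsingular on the imaginary axis for all delays. -/
theorem IsStronglyExpStable.isUnit_reducedMatrix {S : DDAE n m p q}
    {U V : Matrix (Fin n) (Fin ν) ℝ} (hU : IsNullspaceBasis S.Eᵀ U) (hV : IsNullspaceBasis S.E V)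
    (hA₀ : IsUnit (Uᵀ * S.A₀ * V).det) {τ : EuclideanSpace ℝ (Fin m)} (hτ : ∀ i, 0 < τ i)
    (hS : S.IsStronglyExpStable τ) {s : Fin m → ℂ} (hs : ∀ i, ‖s i‖ = 1) :
    IsUnit (S.reducedMatrix U V s) := by
  obtain ⟨ε, hε, hstab⟩ := hS
  -- Delays `r` near `τ` for which the system is stable and the factors at `iω` are exactly `s`.
  obtain ⟨ω, -, -, r, hrτ, hr, hrs⟩ := exists_mem_ball_exp_eq hτ hs hε 0
  replace hrs : delayFactors r (ω * Complex.I) = s := hrs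
  obtain ⟨α, hα, hunit⟩ := (hstab r ⟨hrτ, fun i => (hr i).le⟩).exists_forall_isUnit_charMatrix
  obtain ⟨δ, M, R, hδ, hM⟩ := exists_norm_inv_charMatrix_le hU hV hA₀ hr hα hunit ω
  by_contra hsing
  rw [isUnit_iff_isUnit_det, isUnit_iff_ne_zero, not_not] at hsing
  obtain ⟨v, hv, hDv⟩ := exists_mulVec_eq_zero_iff.2 hsing
  set N : Matrix (Fin ν) (Fin 1) ℂ := replicateCol (Fin 1) v
  have hDN : S.reducedMatrix U V s * N = 0 := by
    ext i j
    exact congrFun hDv i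
  obtain ⟨ω', hω', hphase, hz0, hzinv, hslim⟩ := exists_seq_delayFactors_tendsto r ω R hδ
  rw [hrs] at hslim
  obtain ⟨X, hXlim, hres⟩ := exists_tendsto_charMatrix_mul hU hV hDN hz0 hzinv hslim
  have hX0 : Tendsto X atTop (𝓝 0) := by
    rw [tendsto_zero_iff_norm_tendsto_zero] at hres ⊢
    refine squeeze_zero (fun _ => norm_nonneg _) (fun k => ?_)
      (by simpa using hres.const_mul M)
    have hu := (isUnit_iff_isUnit_det _).1
      (hunit (ω * Complex.I + ω' k * Complex.I) (by simp [hα]))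
    have h1 := l2_opNorm_mul (S.charMatrix r (ω * Complex.I + ω' k * Complex.I))⁻¹
      (S.charMatrix r (ω * Complex.I + ω' k * Complex.I) * X k)
    rw [← Matrix.mul_assoc, nonsing_inv_mul _ hu, Matrix.one_mul] at h1
    refine h1.trans ?_
    gcongr
    exact hM (ω' k) (hω' k) (hphase k)
  have hVN : V.map Complex.ofReal * N = 0 := tendsto_nhds_unique hXlim hX0
  -- `V` is injective since `Uᵀ A₀ V` is nonsingular.
  have hN0 : N = 0 := by
    have h1 : S.reducedMatrix U V 0 * N = 0 := by
      rw [reducedMatrix, Matrix.mul_assoc, hVN, Matrix.mul_zero]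
    have hu := (isUnit_iff_isUnit_det _).1 (isUnit_reducedMatrix_zero hA₀)
    rw [← Matrix.one_mul N, ← nonsing_inv_mul _ hu, Matrix.mul_assoc, h1, Matrix.mul_zero]
  exact hv (funext fun i => congrFun (congrFun hN0 i) 0)

/-! ### The strong norms of the two transfer functions -/

/-- The supremum of the norm of the asymptotic transfer function over all factors on the torus. -/
noncomputable def torusGain (S : DDAE n m p q) (U V : Matrix (Fin n) (Fin ν) ℝ) : ℝ≥0∞ :=
  ⨆ s ∈ {s : Fin m → ℂ | ∀ i, ‖s i‖ = 1}, ENNReal.ofReal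
    ‖S.C.map Complex.ofReal * S.limitResolvent U V s * S.B.map Complex.ofReal‖

theorem ofReal_norm_asymptoticTransferFunction (S : DDAE n m p q) (U V : Matrix (Fin n) (Fin ν) ℝ)
    (r : EuclideanSpace ℝ (Fin m)) (z : ℂ) :
    ENNReal.ofReal ‖S.asymptoticTransferFunction U V r z‖ = ENNReal.ofReal
      ‖S.C.map Complex.ofReal * S.limitResolvent U V (delayFactors r z) *
        S.B.map Complex.ofReal‖ := by
  rw [asymptoticTransferFunction_eq, norm_neg]

theorem ofReal_norm_asymptoticTransferFunction_le (S : DDAE n m p q)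
    (U V : Matrix (Fin n) (Fin ν) ℝ) (r : EuclideanSpace ℝ (Fin m)) (ω : ℝ) :
    ENNReal.ofReal ‖S.asymptoticTransferFunction U V r (ω * Complex.I)‖ ≤ S.torusGain U V := by
  rw [ofReal_norm_asymptoticTransferFunction]
  exact le_biSup (fun s : Fin m → ℂ => ENNReal.ofReal
    ‖S.C.map Complex.ofReal * S.limitResolvent U V s * S.B.map Complex.ofReal‖)
    (show _ ∈ {s : Fin m → ℂ | ∀ i, ‖s i‖ = 1} from norm_delayFactors_apply r ω)

/-- The strong norm of the asymptotic transfer function does not depend on the delays, as long as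
they are positive. -/
theorem strongHinfNorm_asymptoticTransferFunction (S : DDAE n m p q)
    (U V : Matrix (Fin n) (Fin ν) ℝ) {τ : EuclideanSpace ℝ (Fin m)} (hτ : ∀ i, 0 < τ i) :
    strongHinfNorm (S.asymptoticTransferFunction U V) τ = S.torusGain U V := by
  apply le_antisymm
  · exact (strongHinfNorm_le_supHinfNorm _ _ one_pos).trans (iSup₂_le fun r _ =>
      hinfNorm_le fun ω => S.ofReal_norm_asymptoticTransferFunction_le U V r ω)
  · refine le_strongHinfNorm fun ε hε => iSup₂_le fun s hs => ?_
    obtain ⟨ω, -, -, r, hr, hr0, hrs⟩ := exists_mem_ball_exp_eq hτ hs hε 0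
    replace hrs : delayFactors r (ω * Complex.I) = s := hrs
    rw [← hrs, ← ofReal_norm_asymptoticTransferFunction]
    exact (ofReal_norm_le_hinfNorm _ ω).trans
      (hinfNorm_le_supHinfNorm _ hr fun i => (hr0 i).le)

theorem torusGain_ne_top {S : DDAE n m p q} {U V : Matrix (Fin n) (Fin ν) ℝ}
    (hD : ∀ s : Fin m → ℂ, (∀ i, ‖s i‖ = 1) → IsUnit (S.reducedMatrix U V s)) :
    S.torusGain U V ≠ ∞ := by
  obtain ⟨c, hc⟩ := isCompact_setOf_forall_norm_eq_one.exists_bound_of_continuousOn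
    (S.continuousOn_limitResolvent U V hD)
  refine ne_top_of_le_ne_top (ENNReal.ofReal_ne_top (r := ‖S.C.map Complex.ofReal‖ * c *
    ‖S.B.map Complex.ofReal‖)) (iSup₂_le fun s hs => ENNReal.ofReal_le_ofReal ?_)
  refine (l2_opNorm_mul _ _).trans ?_
  gcongr
  refine (l2_opNorm_mul _ _).trans ?_
  gcongr
  exact hc s hs

/-- At high frequencies the transfer function is close to the asymptotic one, uniformly in the
delays. -/
theorem exists_forall_norm_transferFunction_sub_le {S : DDAE n m p q}
    {U V : Matrix (Fin n) (Fin ν) ℝ} (hU : IsNullspaceBasis S.Eᵀ U) (hV : IsNullspaceBasis S.E V)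
    (hD : ∀ s : Fin m → ℂ, (∀ i, ‖s i‖ = 1) → IsUnit (S.reducedMatrix U V s))
    {η : ℝ} (hη : 0 < η) :
    ∃ Ω : ℝ, ∀ (r : EuclideanSpace ℝ (Fin m)) (ω : ℝ), Ω ≤ |ω| →
      ‖S.transferFunction r (ω * Complex.I) -
        S.asymptoticTransferFunction U V r (ω * Complex.I)‖ ≤ η := by
  obtain ⟨c, R, hc, hR, h⟩ := exists_forall_norm_inv_add_limitResolvent_le hU hV
    isCompact_setOf_forall_norm_eq_one hD
  set b := ‖S.C.map Complex.ofReal‖ * c * ‖S.B.map Complex.ofReal‖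
  refine ⟨max R (b / η), fun r ω hω => ?_⟩
  have hnorm : ‖(ω * Complex.I : ℂ)‖ = |ω| := by simp
  obtain ⟨-, h1⟩ := (h _ (norm_delayFactors_apply r ω)).2 (ω * Complex.I)
    (by rw [hnorm]; exact (le_max_left _ _).trans hω)
  have hω0 : 0 < |ω| := by linarith [(le_max_left _ _).trans hω]
  rw [← S.charMatrix_eq, hnorm] at h1
  rw [asymptoticTransferFunction_eq, transferFunction, sub_neg_eq_add, ← Matrix.add_mul,
    ← Matrix.mul_add]
  calc _ ≤ ‖S.C.map Complex.ofReal‖ * (c / |ω|) * ‖S.B.map Complex.ofReal‖ := by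
        refine (l2_opNorm_mul _ _).trans ?_
        gcongr
        refine (l2_opNorm_mul _ _).trans ?_
        gcongr
    _ = b / |ω| := by ring
    _ ≤ η := by
        rw [div_le_iff₀ hω0, ← div_le_iff₀' hη]
        exact (le_max_right _ _).trans hω

theorem torusGain_le_strongHinfNorm_transferFunction {S : DDAE n m p q}
    {U V : Matrix (Fin n) (Fin ν) ℝ} (hU : IsNullspaceBasis S.Eᵀ U) (hV : IsNullspaceBasis S.E V)
    (hD : ∀ s : Fin m → ℂ, (∀ i, ‖s i‖ = 1) → IsUnit (S.reducedMatrix U V s))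
    {τ : EuclideanSpace ℝ (Fin m)} (hτ : ∀ i, 0 < τ i) :
    S.torusGain U V ≤ strongHinfNorm S.transferFunction τ := by
  refine le_strongHinfNorm fun ε hε => iSup₂_le fun s hs =>
    ENNReal.le_of_forall_pos_le_add fun η hη _ => ?_
  obtain ⟨Ω, hΩ⟩ := exists_forall_norm_transferFunction_sub_le hU hV hD (NNReal.coe_pos.2 hη)
  obtain ⟨ω, hω, -, r, hr, hr0, hrs⟩ := exists_mem_ball_exp_eq hτ hs hε Ω
  replace hrs : delayFactors r (ω * Complex.I) = s := hrs
  rw [← hrs, ← ofReal_norm_asymptoticTransferFunction]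
  have h1 := hΩ r ω (hω.trans (le_abs_self ω))
  rw [norm_sub_rev] at h1
  refine (ofReal_norm_le_add h1).trans ?_
  rw [ENNReal.ofReal_coe_nnreal]
  gcongr
  exact (ofReal_norm_le_hinfNorm _ ω).trans
      (hinfNorm_le_supHinfNorm _ hr fun i => (hr0 i).le)

theorem continuousAt_transferFunction (S : DDAE n m p q) {r : EuclideanSpace ℝ (Fin m)} {ω : ℝ}
    (h : IsUnit (S.charMatrix r (ω * Complex.I))) :
    ContinuousAt (fun x : EuclideanSpace ℝ (Fin m) × ℝ =>
      S.transferFunction x.1 (x.2 * Complex.I)) (r, ω) := by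
  have h1 : Continuous fun x : EuclideanSpace ℝ (Fin m) × ℝ =>
      S.charMatrix x.1 (x.2 * Complex.I) := by
    unfold charMatrix
    fun_prop
  have h2 : ContinuousAt (fun x : EuclideanSpace ℝ (Fin m) × ℝ =>
      (S.charMatrix x.1 (x.2 * Complex.I))⁻¹) (r, ω) :=
    ContinuousAt.comp (g := fun N : Matrix (Fin n) (Fin n) ℂ => N⁻¹)
      (f := fun x : EuclideanSpace ℝ (Fin m) × ℝ => S.charMatrix x.1 (x.2 * Complex.I))
      (Matrix.continuousAt_inv h) h1.continuousAt
  have h3 : Continuous fun N : Matrix (Fin n) (Fin n) ℂ =>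
      S.C.map Complex.ofReal * N * S.B.map Complex.ofReal :=
    (continuous_const.matrix_mul continuous_id).matrix_mul continuous_const
  exact ContinuousAt.comp (g := fun N : Matrix (Fin n) (Fin n) ℂ =>
    S.C.map Complex.ofReal * N * S.B.map Complex.ofReal) h3.continuousAt h2

/-- On bounded frequency intervals the transfer function depends continuously on the delays,
uniformly in the frequency. -/
theorem eventually_forall_norm_transferFunction_sub_le (S : DDAE n m p q)
    {τ : EuclideanSpace ℝ (Fin m)} (hunit : ∀ ω : ℝ, IsUnit (S.charMatrix τ (ω * Complex.I)))
    (Ω : ℝ) {η : ℝ} (hη : 0 < η) :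
    ∀ᶠ r in 𝓝 τ, ∀ ω ∈ Icc (-Ω) Ω, ‖S.transferFunction r (ω * Complex.I) -
      S.transferFunction τ (ω * Complex.I)‖ ≤ η := by
  refine isCompact_Icc.eventually_forall_of_forall_eventually fun ω _ => ?_
  have h1 := S.continuousAt_transferFunction (hunit ω)
  have h2 : ContinuousAt (fun x : EuclideanSpace ℝ (Fin m) × ℝ =>
      S.transferFunction τ (x.2 * Complex.I)) (τ, ω) :=
    ContinuousAt.comp (g := fun x : EuclideanSpace ℝ (Fin m) × ℝ =>
      S.transferFunction x.1 (x.2 * Complex.I))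
      (f := fun x : EuclideanSpace ℝ (Fin m) × ℝ => (τ, x.2)) h1 (by fun_prop)
  have h3 := (h1.sub h2).norm
  have h4 := h3.tendsto.eventually_le_const (u := η) (by simpa using hη)
  exact h4

/-- Small changes of the delays change the norm of the transfer function only slightly, except at
high frequencies, where it is controlled by `torusGain`. -/
theorem eventually_hinfNorm_transferFunction_le {S : DDAE n m p q}
    {U V : Matrix (Fin n) (Fin ν) ℝ} (hU : IsNullspaceBasis S.Eᵀ U) (hV : IsNullspaceBasis S.E V)
    (hD : ∀ s : Fin m → ℂ, (∀ i, ‖s i‖ = 1) → IsUnit (S.reducedMatrix U V s))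
    {τ : EuclideanSpace ℝ (Fin m)} (hunit : ∀ ω : ℝ, IsUnit (S.charMatrix τ (ω * Complex.I)))
    {η : ℝ} (hη : 0 < η) :
    ∀ᶠ r in 𝓝 τ,
      hinfNorm (S.transferFunction r) ≤
        max (hinfNorm (S.transferFunction τ)) (S.torusGain U V) + ENNReal.ofReal η ∧
      hinfNorm (S.transferFunction τ) ≤
        max (hinfNorm (S.transferFunction r)) (S.torusGain U V) + ENNReal.ofReal η := by
  obtain ⟨Ω, hΩ⟩ := exists_forall_norm_transferFunction_sub_le hU hV hD hη
  have key (r r' : EuclideanSpace ℝ (Fin m)) (h : ∀ ω ∈ Icc (-Ω) Ω,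
      ‖S.transferFunction r (ω * Complex.I) - S.transferFunction r' (ω * Complex.I)‖ ≤ η) :
      hinfNorm (S.transferFunction r) ≤
        max (hinfNorm (S.transferFunction r')) (S.torusGain U V) + ENNReal.ofReal η := by
    refine hinfNorm_le fun ω => ?_
    rcases le_total |ω| Ω with hω | hω
    · refine (ofReal_norm_le_add (h ω (abs_le.1 hω))).trans ?_
      gcongr
      exact (ofReal_norm_le_hinfNorm _ ω).trans (le_max_left _ _)
    · refine (ofReal_norm_le_add (hΩ r ω hω)).trans ?_
      gcongr
      exact (S.ofReal_norm_asymptoticTransferFunction_le U V r ω).trans (le_max_right _ _)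
  filter_upwards [S.eventually_forall_norm_transferFunction_sub_le hunit Ω hη] with r hr
  exact ⟨key r τ hr, key τ r fun ω hω => by rw [norm_sub_rev]; exact hr ω hω⟩

theorem hinfNorm_transferFunction_ne_top {S : DDAE n m p q}
    {U V : Matrix (Fin n) (Fin ν) ℝ} (hU : IsNullspaceBasis S.Eᵀ U) (hV : IsNullspaceBasis S.E V)
    (hD : ∀ s : Fin m → ℂ, (∀ i, ‖s i‖ = 1) → IsUnit (S.reducedMatrix U V s))
    {τ : EuclideanSpace ℝ (Fin m)} (hunit : ∀ ω : ℝ, IsUnit (S.charMatrix τ (ω * Complex.I))) :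
    hinfNorm (S.transferFunction τ) ≠ ∞ := by
  obtain ⟨Ω, hΩ⟩ := exists_forall_norm_transferFunction_sub_le hU hV hD one_pos
  have hcont : Continuous fun ω : ℝ => S.transferFunction τ (ω * Complex.I) :=
    continuous_iff_continuousAt.2 fun ω =>
      ContinuousAt.comp (g := fun x : EuclideanSpace ℝ (Fin m) × ℝ =>
        S.transferFunction x.1 (x.2 * Complex.I)) (f := fun ω : ℝ => (τ, ω))
        (S.continuousAt_transferFunction (hunit ω)) (by fun_prop)
  obtain ⟨c, hc⟩ := (isCompact_Icc (a := -Ω) (b := Ω)).exists_bound_of_continuousOn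
    hcont.continuousOn
  refine ne_top_of_le_ne_top (b := max (ENNReal.ofReal c) (S.torusGain U V + ENNReal.ofReal 1))
    (by simp [torusGain_ne_top hD]) (hinfNorm_le fun ω => ?_)
  rcases le_total |ω| Ω with hω | hω
  · exact le_max_of_le_left (ENNReal.ofReal_le_ofReal (hc ω (abs_le.1 hω)))
  · refine le_max_of_le_right ((ofReal_norm_le_add (hΩ τ ω hω)).trans ?_)
    gcongr
    exact S.ofReal_norm_asymptoticTransferFunction_le U V τ ω

theorem IsStronglyExpStable.isUnit_charMatrix {S : DDAE n m p q} {τ : EuclideanSpace ℝ (Fin m)}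
    (hτ : ∀ i, 0 < τ i) (hS : S.IsStronglyExpStable τ) (ω : ℝ) :
    IsUnit (S.charMatrix τ (ω * Complex.I)) := by
  obtain ⟨ε, hε, h⟩ := hS
  obtain ⟨α, hα, hunit⟩ := (h τ ⟨Metric.mem_ball_self hε, fun i => (hτ i).le⟩
    ).exists_forall_isUnit_charMatrix
  exact hunit _ (by simp [hα])

theorem IsStronglyExpStable.eventually {S : DDAE n m p q} {τ : EuclideanSpace ℝ (Fin m)}
    (hS : S.IsStronglyExpStable τ) : ∀ᶠ r in 𝓝 τ, S.IsStronglyExpStable r := by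
  obtain ⟨ε, hε, h⟩ := hS
  filter_upwards [Metric.ball_mem_nhds τ hε] with r hr
  refine ⟨ε - dist r τ, sub_pos.2 hr, fun r' hr' => h r' ⟨?_, hr'.2⟩⟩
  exact Metric.ball_subset_ball' (by simp) hr'.1

theorem IsStronglyExpStable.strongHinfNorm_transferFunction {S : DDAE n m p q}
    {U V : Matrix (Fin n) (Fin ν) ℝ} (hU : IsNullspaceBasis S.Eᵀ U) (hV : IsNullspaceBasis S.E V)
    (hA₀ : IsUnit (Uᵀ * S.A₀ * V).det) {τ : EuclideanSpace ℝ (Fin m)} (hτ : ∀ i, 0 < τ i)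
    (hS : S.IsStronglyExpStable τ) :
    strongHinfNorm S.transferFunction τ =
      max (hinfNorm (S.transferFunction τ)) (S.torusGain U V) := by
  have hD := fun s => hS.isUnit_reducedMatrix (s := s) hU hV hA₀ hτ
  apply le_antisymm
  · refine ENNReal.le_of_forall_pos_le_add fun η hη _ => ?_
    obtain ⟨ε, hε, h⟩ := Metric.eventually_nhds_iff_ball.1
      (eventually_hinfNorm_transferFunction_le hU hV hD (hS.isUnit_charMatrix hτ)
        (NNReal.coe_pos.2 hη))
    refine (strongHinfNorm_le_supHinfNorm _ _ hε).trans (iSup₂_le fun r hr => ?_)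
    simpa only [ENNReal.ofReal_coe_nnreal] using (h r hr.1).1
  · refine max_le (le_strongHinfNorm fun ε hε => ?_)
      (torusGain_le_strongHinfNorm_transferFunction hU hV hD hτ)
    exact hinfNorm_le_supHinfNorm _ (Metric.mem_ball_self hε) fun i => (hτ i).le

theorem IsStronglyExpStable.continuousWithinAt_strongHinfNorm {S : DDAE n m p q}
    {U V : Matrix (Fin n) (Fin ν) ℝ} (hU : IsNullspaceBasis S.Eᵀ U) (hV : IsNullspaceBasis S.E V)
    (hA₀ : IsUnit (Uᵀ * S.A₀ * V).det) {τ : EuclideanSpace ℝ (Fin m)} (hτ : ∀ i, 0 < τ i)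
    (hS : S.IsStronglyExpStable τ) :
    ContinuousWithinAt (strongHinfNorm S.transferFunction) {r | ∀ i, 0 < r i} τ := by
  have hD := fun s => hS.isUnit_reducedMatrix (s := s) hU hV hA₀ hτ
  have hunit := hS.isUnit_charMatrix hτ
  have hfin : strongHinfNorm S.transferFunction τ ≠ ∞ := by
    rw [hS.strongHinfNorm_transferFunction hU hV hA₀ hτ]
    simp [torusGain_ne_top hD, hinfNorm_transferFunction_ne_top hU hV hD hunit]
  rw [ContinuousWithinAt, ENNReal.tendsto_nhds hfin]
  intro ε hε
  obtain ⟨η, hη, hηε⟩ : ∃ η : ℝ, 0 < η ∧ ENNReal.ofReal η ≤ ε := by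
    obtain ⟨η, hη, hηε⟩ := ENNReal.lt_iff_exists_nnreal_btwn.1 hε
    exact ⟨η, by exact_mod_cast hη, by rw [ENNReal.ofReal_coe_nnreal]; exact hηε.le⟩
  filter_upwards [self_mem_nhdsWithin, mem_nhdsWithin_of_mem_nhds hS.eventually,
    mem_nhdsWithin_of_mem_nhds
      (eventually_hinfNorm_transferFunction_le hU hV hD hunit hη)] with r hr hSr hclose
  rw [hS.strongHinfNorm_transferFunction hU hV hA₀ hτ,
    IsStronglyExpStable.strongHinfNorm_transferFunction hU hV hA₀ hr hSr]
  constructor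
  · rw [tsub_le_iff_right]
    refine (max_le hclose.2 (le_add_right (le_max_right _ _))).trans ?_
    gcongr
  · refine (max_le hclose.1 (le_add_right (le_max_right _ _))).trans ?_
    gcongr

end DDAE

end

theorem mainTheorem1 {n m p q ν : ℕ} (S : DDAE n m p q)
    (U V : Matrix (Fin n) (Fin ν) ℝ)
    (hU : IsNullspaceBasis S.Eᵀ U) (hV : IsNullspaceBasis S.E V)
    (hA₀ : IsUnit (Uᵀ * S.A₀ * V).det) :
    ∀ τ : EuclideanSpace ℝ (Fin m), (∀ i, 0 < τ i) → S.IsStronglyExpStable τ →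
      strongHinfNorm S.transferFunction τ ≠ ∞ ∧
      strongHinfNorm S.transferFunction τ =
        max (hinfNorm (S.transferFunction τ))
          (strongHinfNorm (S.asymptoticTransferFunction U V) τ) ∧
      ContinuousWithinAt (strongHinfNorm S.transferFunction) {r | ∀ i, 0 < r i} τ := by
  intro τ hτ hS
  have hD := fun s => hS.isUnit_reducedMatrix (s := s) hU hV hA₀ hτ
  have heq := hS.strongHinfNorm_transferFunction hU hV hA₀ hτ
  refine ⟨?_, ?_, hS.continuousWithinAt_strongHinfNorm hU hV hA₀ hτ⟩
  · rw [heq]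
    simp [DDAE.torusGain_ne_top hD,
      DDAE.hinfNorm_transferFunction_ne_top hU hV hD (hS.isUnit_charMatrix hτ)]
  · rw [heq, S.strongHinfNorm_asymptoticTransferFunction U V hτ]
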